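/- Let $(\mathcal A,E,\mathcal B)$ be an operator-valued $C^*$-probability space: $\mathcal A$ is a unital $C^*$-algebra, $\mathcal B\subseteq\mathcal A$ a unital $*$-subalgebra, and $E:\mathcal A\to\mathcal B$ a completely positive conditional expectation, i.e. a completely positive linear map with $E[b]=b$ and $E[b_1ab_2]=b_1E[a]b_2$ for $b,b_1,b_2\in\mathcal B$, $a\in\mathcal A$. Let $\eta_0,\eta_1:\mathcal B\to\mathcal B$ be bounded linear maps, and for $i=0,1$ let $A_i=A_i^*\in\mathcal A$ be a $\mathcal B$-valued arcsine element with covariance map $\eta_i$. This means that $E[A_i]=0$ and that, for all $k\ge 0$ and $b_0,\dots,b_k\in\mathcal B$, $$E[b_0A_ib_1A_i\cdots A_ib_k]=\sum_{\pi\in NC_2(k)}\frac1{\tau(\pi)!}\,b_0\,(\eta_i)_\pi(b_1,\dots,b_{k-1})\,b_k\quad (k \text{ even}),\qquad E[b_0A_ib_1A_i\cdots A_ib_k]=0\quad (k\text{ odd}).$$ Here $NC_2(k)$ is the set of noncrossing pair partitions of $\{1,\dots,k\}$; $\tau(\pi)!=\prod_{V\in\pi}\#\{W\in\pi: W\subseteq\{\min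 V,\dots,\max V\}\}$; and $b_0\,\eta_\pi(b_1,\dots,b_{k-1})\,b_k$ is obtained from the word $b_0xb_1x\cdots xb_k$ by replacing the pairs of letters $x\,w\,x$ that form the blocks of $\pi$ by $\eta(w)$, from the innermost outwards (for $k=0$ it is $b_0$). In particular $\eta_i(b)=E[A_ibA_i]$. For $k\in\mathbb N$ let $\mathbb H^+(M_k(\mathcal B))$ be the set of $b\in M_k(\mathcal B)$ whose imaginary part $\operatorname{Im} b=\frac1{2i}(b-b^*)$ is positive and invertible, and for $x=x^*\in\mathcal A$ let $\mathcal G^{M_k(\mathcal B)}_{1_k\otimes x}(b)=(\mathrm{id}_k\otimes E)\big[(b-1_k\otimes x)^{-1}\big]$. Then: 1. For every $k\in\mathbb N$ and every $b\in\mathbb H^+(M_k(\mathcal B))$, $$\big\|\mathcal G^{M_k(\mathcal B)}_{1_k\otimes A_1}(b)-\mathcal G^{M_k(\mathcal B)}_{1_k\otimes A_0}(b)\big\|\le k\,\|(\operatorname{Im} b)^{-1}\|^3\,\|\eta_1-\eta_0\|.$$ 2. Suppose moreover that $(\mathcal A,\varphi)$ is a $W^*$-probability space (that is, $\mathcal A$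 is a von Neumann algebra and $\varphi$ a faithful normal state on it) with $\varphi\circ E=\varphi$. For $x=x^*\in\mathcal A$ let $\mathcal G_x(z)=\varphi[(z-x)^{-1}]$ for $\operatorname{Im} z>0$, and let $\mu_x$ be the distribution of $x$ with respect to $\varphi$, i.e. the Borel probability measure on $\mathbb R$ with $\int f\,d\mu_x=\varphi(f(x))$ for all continuous $f$. Then for every $\varepsilon>0$ the function $t\mapsto\mathcal G_{A_1}(t+i\varepsilon)-\mathcal G_{A_0}(t+i\varepsilon)$ is integrable on $\mathbb R$ and $$\frac1\pi\int_{\mathbb R}\big|\mathcal G_{A_1}(t+i\varepsilon)-\mathcal G_{A_0}(t+i\varepsilon)\big|\,dt\le\frac1{\varepsilon^2}\,\|\eta_1-\eta_0\|.$$ Moreover $$L(\mu_{A_1},\mu_{A_0})\le c\,\|\eta_1-\eta_0\|^{1/5},\qquad c=5\Big(\frac1{4\pi}\Big)^{2/5}<1.817,$$ where $L(\mu,\nu)=\inf\{\epsilon>0:\ \mu(-\infty,t-\epsilon]-\epsilon\le\nu(-\infty,t]\le\mu(-\infty,t+\epsilon]+\epsilon\ \ \forall t\in\mathbb R\}$ is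 the Lévy distance. -/

import Mathlib

open scoped CStarAlgebra ComplexStarModule ComplexOrder CompactlySupported
open MeasureTheory

namespace OVArcsine

/-! ### Noncrossing pair partitions -/

/-- The set `NC₂(k)` of noncrossing pair partitions of a set of `k` linearly ordered points
(here `Fin k`). A pair partition is encoded by the fixed-point-free involution `σ` that sends each
point to the other point of its block; it is noncrossing if there are no two blocks
`{i, σ i}`, `{j, σ j}` with `i < j < σ i < σ j`. -/
def NC2 (k : ℕ) : Finset (Fin k → Fin k) :=
  Finset.univ.filter fun σ =>
    (∀ i, σ (σ i) = i) ∧ (∀ i, σ i ≠ i) ∧ ∀ i j, ¬ (i < j ∧ j < σ i ∧ σ i < σ j)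

/-- The tree factorial `τ(π)!` of a pair partition: the product over all blocks `V = {i < σ i}` of
the number of blocks `W = {j < σ j}` with `W ⊆ {min V, …, max V}`. -/
def treeFactorial {k : ℕ} (σ : Fin k → Fin k) : ℕ :=
  ∏ i ∈ Finset.univ.filter (fun i => i < σ i),
    (Finset.univ.filter fun j => j < σ j ∧ i ≤ j ∧ σ j ≤ σ i).card

/-- Value of the word `b_lo x b_{lo+1} x ⋯ x b_hi` (the letters `x` occupy the positions
`lo, …, hi - 1`) when the letters `x` are paired by the noncrossing pairing `p` and every pair
`x w x` is replaced, in the nested way, by `η w`: the letter in position `lo` is paired with the one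
in position `p lo`, the subword strictly between them is evaluated first, and the subword to the
right of position `p lo` is evaluated separately. -/
def nestedWord {R : Type*} [Mul R] (η : R → R) (p : ℕ → ℕ) (b : ℕ → R) (lo hi : ℕ) : R :=
  if _h : lo < p lo ∧ p lo < hi then
    b lo * η (nestedWord η p b (lo + 1) (p lo)) * nestedWord η p b (p lo + 1) hi
  else b lo
termination_by hi - lo
decreasing_by all_goals omega

/-- `b₀ η_π(b₁, …, b_{k-1}) b_k` for a noncrossing pair partition `π` of `k` points. -/
def nestedValue {R : Type*} [Mul R] (η : R → R) {k : ℕ} (σ : Fin k → Fin k) (b : ℕ → R) : R :=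
  nestedWord η (fun i => if h : i < k then (σ ⟨i, h⟩ : ℕ) else i) b 0 k

/-- The product `b₀ x b₁ x ⋯ x b_k` with `k` factors `x`. -/
def word {R : Type*} [Mul R] (x : R) (b : ℕ → R) : ℕ → R
  | 0 => b 0
  | k + 1 => word x b k * x * b (k + 1)

noncomputable section

/-! ### Operator-valued probability spaces -/

section

variable {A : Type*} [CStarAlgebra A] [PartialOrder A] [StarOrderedRing A]

/-- `(A, E, B)` is an operator-valued C⋆-probability space: `A` is a unital C⋆-algebra, `B` a unital
⋆-subalgebra and `E` a completely positive conditional expectation of `A` onto `B`. (As `E` is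
continuous, `B = {a | E a = a}` is automatically closed. Complete positivity is the same for `E` as
a map into `A` or into `B`.) -/
structure IsOVProbabilitySpace (B : StarSubalgebra ℂ A) (E : A →CP A) : Prop where
  map_mem : ∀ a, E a ∈ B
  map_of_mem : ∀ b ∈ B, E b = b
  map_bimodule : ∀ b₁ ∈ B, ∀ b₂ ∈ B, ∀ a, E (b₁ * a * b₂) = b₁ * E a * b₂

/-- `x` is a `B`-valued arcsine element with variance (covariance map) `η`. -/
structure IsArcsineElement (B : StarSubalgebra ℂ A) (E : A →CP A) (η : B →L[ℂ] B) (x : A) :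
    Prop where
  centered : E x = 0
  moments : ∀ (k : ℕ) (b : ℕ → B),
    E (word x (fun i => (b i : A)) k) =
      if Even k then
        ((∑ σ ∈ NC2 k, ((treeFactorial σ : ℂ)⁻¹) • nestedValue η σ b : B) : A)
      else 0

/-- The amplification `1_k ⊗ x`, i.e. the diagonal matrix with all diagonal entries `x`. -/
def amplify (k : ℕ) (x : A) : CStarMatrix (Fin k) (Fin k) A :=
  CStarMatrix.ofMatrix (Matrix.diagonal fun _ => x)

/-- The upper half plane `ℍ⁺(M_k(B))`, where `M_k(B)` is regarded as a C⋆-subalgebra of `M_k(A)`: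
the matrices over `B` whose imaginary part `(b - b⋆) / 2i` is positive and invertible. -/
def upperHalfPlane (B : StarSubalgebra ℂ A) (k : ℕ) : Set (CStarMatrix (Fin k) (Fin k) A) :=
  {b | (∀ i j, b i j ∈ B) ∧ IsStrictlyPositive (ℑ b : CStarMatrix (Fin k) (Fin k) A)}

/-- The operator-valued Cauchy transform `(id_k ⊗ E)[(b - 1_k ⊗ x)⁻¹]`. -/
def ovCauchy (E : A →CP A) (k : ℕ) (x : A) (b : CStarMatrix (Fin k) (Fin k) A) :
    CStarMatrix (Fin k) (Fin k) A :=
  (Ring.inverse (b - amplify k x)).map E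

/-! ### States, scalar Cauchy transforms and distributions -/

/-- `(A, φ)` is a W⋆-probability space: `A` is a von Neumann algebra and `φ` a faithful normal state
on `A`. Normality: `φ` preserves suprema of (bounded) upward directed sets of self-adjoint
elements. -/
structure IsWStarProbabilitySpace (φ : A →ₚ[ℂ] ℂ) : Prop where
  wstar : WStarAlgebra A
  map_one : φ 1 = 1
  faithful : ∀ a, φ (star a * a) = 0 → a = 0
  normal : ∀ (D : Set A) (s : A), D.Nonempty → DirectedOn (· ≤ ·) D →
    (∀ a ∈ D, IsSelfAdjoint a) → IsLUB D s → IsLUB (φ '' D) (φ s)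

/-- The scalar Cauchy transform `φ[(z - x)⁻¹]`. -/
def scalarCauchy (φ : A →ₚ[ℂ] ℂ) (x : A) (z : ℂ) : ℂ :=
  φ (Ring.inverse (algebraMap ℂ A z - x))

/-- The positive functional `f ↦ φ(f(x))` on the continuous functions on the spectrum of a
self-adjoint element `x`. -/
def spectralFunctional (φ : A →ₚ[ℂ] ℂ) {x : A} (hx : IsSelfAdjoint x) :
    C_c(spectrum ℝ x, ℝ) →ₚ[ℝ] ℝ :=
  PositiveLinearMap.mk₀
    { toFun := fun f => (φ (cfcHom (R := ℝ) hx f.toContinuousMap)).re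
      map_add' := fun f g => by
        have : (f + g).toContinuousMap = f.toContinuousMap + g.toContinuousMap := rfl
        rw [this, _root_.map_add, _root_.map_add, Complex.add_re]
      map_smul' := fun c f => by
        have : (c • f).toContinuousMap = c • f.toContinuousMap := rfl
        rw [this, _root_.map_smul, ← algebraMap_smul ℂ c, _root_.map_smul]
        simp }
    (fun f hf => by
      have h : 0 ≤ cfcHom (R := ℝ) hx f.toContinuousMap :=
        (cfcHom_nonneg_iff hx).2 fun t => hf t
      exact (Complex.le_def.1 (map_nonneg φ h)).1)

/-- The distribution `μ_x` of the self-adjoint element `x` with respect to the state `φ`: the Borel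
measure on `ℝ`, carried by the spectrum of `x`, with `∫ f dμ_x = φ(f(x))` for all continuous `f`. -/
def distribution (φ : A →ₚ[ℂ] ℂ) {x : A} (hx : IsSelfAdjoint x) : Measure ℝ :=
  (RealRMK.rieszMeasure (spectralFunctional φ hx)).map Subtype.val

/-- The defining property of the distribution. -/
theorem integral_distribution (φ : A →ₚ[ℂ] ℂ) {x : A} (hx : IsSelfAdjoint x) (f : ℝ → ℝ)
    (hf : Continuous f) : ∫ t, f t ∂(distribution φ hx) = (φ (cfc f x)).re := by
  rw [distribution, integral_map measurable_subtype_coe.aemeasurable hf.aestronglyMeasurable]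
  let g : C_c(spectrum ℝ x, ℝ) :=
    { toFun := fun t => f t
      continuous_toFun := hf.comp continuous_subtype_val
      hasCompactSupport' := HasCompactSupport.of_compactSpace _ }
  have h := RealRMK.integral_rieszMeasure (spectralFunctional φ hx) g
  rw [cfc_apply f x hx hf.continuousOn]
  exact h

end

/-- The Lévy distance of two Borel probability measures on `ℝ`, in terms of their distribution
functions `t ↦ μ (-∞, t]`. -/
def levyDist (μ ν : Measure ℝ) : ℝ :=
  sInf {ε : ℝ | 0 < ε ∧ ∀ t : ℝ,
    μ.real (Set.Iic (t - ε)) - ε ≤ ν.real (Set.Iic t) ∧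
      ν.real (Set.Iic t) ≤ μ.real (Set.Iic (t + ε)) + ε}

end

end OVArcsine

namespace OVArcsine

noncomputable section

set_option linter.unusedSectionVars false

/-! ### First-block decomposition of noncrossing pairings -/

/-! The tree factorial turns the moment recursion into an autonomous differential equation. Removing
the block of the first point splits a pairing into an inner and an outer one, and that block
contributes the weight `2 / (m + 2)`, with `m` the number of inner points (`arcsineSum_add_two`).
Let `G_u(b) = Φ[(b - u x)⁻¹]` and `F_u = G_u⁻¹`. Summed over all moments, the recursion reads
`F_u(b) = b - ∑ 2/(k+2) u^(k+2) H(m_k)`. Differentiating cancels the denominators: `dF_u/du = -2u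
H(F_u⁻¹)`, and with `u = √s`, `dF/ds = -H(F⁻¹)`. This holds for small `u` by the Neumann series and
for all `u` by analyticity (`hasDerivAt_inverse_cauchyTransform`). On the half plane `Im ≥ ε`, which
`F` preserves, the vector field is Lipschitz, so uniqueness makes `F` a semigroup (`flow_add`).

To compare `x₀` with `x₁`, run the flow of `x₀` for time `1 - s` and then apply the Cauchy transform
of `√s x₁`. This interpolates between the two Cauchy transforms. By the semigroup law, one step of
length `h` only replaces an `x₀`-flow of duration `h` by an `x₁`-flow of the same duration
(`exists_interpolation_increment`), which costs `K h / ε + O(h²)` when `H₁ - H₀` has norm at most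
`K` (`norm_flow_sub_flow_le`). Cutting `[0, 1]` into `N` steps and letting `N → ∞` removes the
quadratic error.

In norm, the two resolvents around the increment contribute `1 / ε²`, hence `K / ε³`
(`norm_cauchyTransform_sub_le`); the factor `k` for matrices comes from amplifying `H₁ - H₀`. Under
a state, Cauchy–Schwarz and `ε φ(R R⋆) ≤ -Im φ(R)` bound each step by a multiple of functions of
total integral `π` along the line `Im z = ε`, hence `π K / ε²` in `L¹`
(`integral_norm_cauchyTransform_sub_le`). Convolution with a Cauchy law of scale `ε` changes
distribution functions, up to shift and error, by `√(ε/π)`, so the `L¹` bound controls the Lévy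
distance; optimizing `ε` gives the exponent `1/5`. -/

/-- The four kinds of points are the first one, those under its arc, its partner, and those to the
right of the partner. -/
theorem forall_fin_add_succ {m l : ℕ} {P : Fin ((m + 1) + (l + 1)) → Prop} :
    (∀ i, P i) ↔ P (Fin.castAdd (l + 1) 0) ∧ (∀ i : Fin m, P (Fin.castAdd (l + 1) i.succ)) ∧
      P (Fin.natAdd (m + 1) 0) ∧ ∀ i : Fin l, P (Fin.natAdd (m + 1) i.succ) := by
  constructor
  · exact fun h => ⟨h _, fun _ => h _, h _, fun _ => h _⟩
  · rintro ⟨h0, h1, h2, h3⟩ i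
    refine Fin.addCases (fun j => ?_) (fun j => ?_) i
    · exact Fin.cases h0 h1 j
    · exact Fin.cases h2 h3 j

/-- The pairing in which the first point is paired with the point number `m + 1`, the `m` points
in between are paired by `σ` and the remaining ones by `τ`. -/
def joinPairing {m l : ℕ} (σ : Fin m → Fin m) (τ : Fin l → Fin l) :
    Fin ((m + 1) + (l + 1)) → Fin ((m + 1) + (l + 1)) :=
  Fin.addCases
    (Fin.cases (Fin.natAdd (m + 1) 0) fun i => Fin.castAdd (l + 1) (σ i).succ)
    (Fin.cases (Fin.castAdd (l + 1) 0) fun i => Fin.natAdd (m + 1) (τ i).succ)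

section join

variable {m l : ℕ} (σ : Fin m → Fin m) (τ : Fin l → Fin l)

@[simp] theorem joinPairing_zero :
    joinPairing σ τ (Fin.castAdd (l + 1) 0) = Fin.natAdd (m + 1) 0 := by
  simp only [joinPairing, Fin.addCases_left, Fin.cases_zero]

@[simp] theorem joinPairing_inner (i : Fin m) :
    joinPairing σ τ (Fin.castAdd (l + 1) i.succ) = Fin.castAdd (l + 1) (σ i).succ := by
  simp only [joinPairing, Fin.addCases_left, Fin.cases_succ]

@[simp] theorem joinPairing_mid :
    joinPairing σ τ (Fin.natAdd (m + 1) 0) = Fin.castAdd (l + 1) 0 := by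
  simp only [joinPairing, Fin.addCases_right, Fin.cases_zero]

@[simp] theorem joinPairing_outer (i : Fin l) :
    joinPairing σ τ (Fin.natAdd (m + 1) i.succ) = Fin.natAdd (m + 1) (τ i).succ := by
  simp only [joinPairing, Fin.addCases_right, Fin.cases_succ]

theorem mem_NC2 {k : ℕ} {σ : Fin k → Fin k} : σ ∈ NC2 k ↔
    (∀ i, σ (σ i) = i) ∧ (∀ i, σ i ≠ i) ∧ ∀ i j, ¬ (i < j ∧ j < σ i ∧ σ i < σ j) := by
  simp [NC2]

theorem joinPairing_mem_NC2 : joinPairing σ τ ∈ NC2 ((m + 1) + (l + 1)) ↔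
    σ ∈ NC2 m ∧ τ ∈ NC2 l := by
  simp only [mem_NC2, forall_fin_add_succ, joinPairing_zero, joinPairing_inner, joinPairing_mid,
    joinPairing_outer, Fin.lt_def, Fin.ext_iff, Fin.val_castAdd, Fin.val_natAdd, Fin.val_succ,
    ne_eq, Fin.val_zero]
  constructor
  · rintro ⟨⟨-, a1, -, a2⟩, ⟨-, b1, -, b2⟩, -, c1, -, c2⟩
    refine ⟨⟨fun i => ?_, fun i => ?_, fun i j => ?_⟩, fun i => ?_, fun i => ?_, fun i j => ?_⟩
    · have := a1 i; omega
    · have := b1 i; omega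
    · have := (c1 i).2.1 j; omega
    · have := a2 i; omega
    · have := b2 i; omega
    · have := (c2 i).2.2.2 j; omega
  · rintro ⟨⟨a1, b1, c1⟩, a2, b2, c2⟩
    refine ⟨⟨trivial, fun i => ?_, trivial, fun i => ?_⟩, ⟨by omega, fun i => ?_, by omega,
      fun i => ?_⟩, ⟨by omega, fun i => ?_, by omega, fun i => ?_⟩,
      fun i => ⟨by omega, fun j => ?_, by omega, fun j => ?_⟩,
      ⟨by omega, fun i => ?_, by omega, fun i => ?_⟩,
      fun i => ⟨by omega, fun j => ?_, by omega, fun j => ?_⟩⟩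
    · have := a1 i; omega
    · have := a2 i; omega
    · have := b1 i; omega
    · have := b2 i; omega
    · have := (σ i).2; omega
    · omega
    · have := c1 i j; omega
    · have := (σ i).2; omega
    · omega
    · omega
    · have := (σ j).2; omega
    · have := c2 i j; omega

theorem joinPairing_injective {m l : ℕ} {σ σ' : Fin m → Fin m} {τ τ' : Fin l → Fin l}
    (h : joinPairing σ τ = joinPairing σ' τ') : σ = σ' ∧ τ = τ' := by
  refine ⟨funext fun i => ?_, funext fun i => ?_⟩
  · have := congrFun h (Fin.castAdd (l + 1) i.succ)
    simpa using this
  · have := congrFun h (Fin.natAdd (m + 1) i.succ)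
    simpa using this

/-- No arc may cross the arc of the first point, so `ρ` preserves the points below it and the points
to its right. -/
theorem exists_joinPairing_eq {ρ : Fin ((m + 1) + (l + 1)) → Fin ((m + 1) + (l + 1))}
    (hρ : ρ ∈ NC2 _) (h0 : (ρ (Fin.castAdd (l + 1) 0) : ℕ) = m + 1) :
    ∃ (σ : Fin m → Fin m) (τ : Fin l → Fin l), joinPairing σ τ = ρ := by
  obtain ⟨inv, ne, nc⟩ := mem_NC2.1 hρ
  have h0' : ρ (Fin.castAdd (l + 1) 0) = Fin.natAdd (m + 1) 0 := Fin.ext (by simp [h0])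
  have hm : ρ (Fin.natAdd (m + 1) 0) = Fin.castAdd (l + 1) 0 := by rw [← h0', inv]
  have key : ∀ i, ρ i = Fin.castAdd (l + 1) 0 → i = Fin.natAdd (m + 1) 0 := fun i hi => by
    rw [← inv i, hi, h0']
  have key' : ∀ i, ρ i = Fin.natAdd (m + 1) 0 → i = Fin.castAdd (l + 1) 0 := fun i hi => by
    rw [← inv i, hi, hm]
  have hi : ∀ i : Fin m, ∃ j : Fin m,
      Fin.castAdd (l + 1) j.succ = ρ (Fin.castAdd (l + 1) i.succ) := by
    intro i
    have h1 := key (Fin.castAdd (l + 1) i.succ)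
    have h2 := key' (Fin.castAdd (l + 1) i.succ)
    have h3 := nc (Fin.castAdd (l + 1) 0) (Fin.castAdd (l + 1) i.succ)
    simp only [Fin.lt_def, Fin.ext_iff, Fin.val_castAdd, Fin.val_natAdd, Fin.val_succ,
      Fin.val_zero, h0] at h1 h2 h3
    have := i.2
    exact ⟨⟨ρ (Fin.castAdd (l + 1) i.succ) - 1, by omega⟩, Fin.ext (by simp; omega)⟩
  have ho : ∀ i : Fin l, ∃ j : Fin l,
      Fin.natAdd (m + 1) j.succ = ρ (Fin.natAdd (m + 1) i.succ) := by
    intro i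
    have h1 := key (Fin.natAdd (m + 1) i.succ)
    have h2 := key' (Fin.natAdd (m + 1) i.succ)
    -- The crossing condition is tested on the image of the outer point: if that image lay inside,
    -- it would open an arc ending outside.
    have h3 := nc (Fin.castAdd (l + 1) 0) (ρ (Fin.natAdd (m + 1) i.succ))
    rw [inv] at h3
    simp only [Fin.lt_def, Fin.ext_iff, Fin.val_castAdd, Fin.val_natAdd, Fin.val_succ,
      Fin.val_zero, h0] at h1 h2 h3
    have := (ρ (Fin.natAdd (m + 1) i.succ)).2
    exact ⟨⟨ρ (Fin.natAdd (m + 1) i.succ) - (m + 1) - 1, by omega⟩, Fin.ext (by simp; omega)⟩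
  choose σ hσ using hi
  choose τ hτ using ho
  refine ⟨σ, τ, funext ?_⟩
  rw [forall_fin_add_succ]
  exact ⟨by simp [h0'], fun i => by simp [hσ], by simp [hm], fun i => by simp [hτ]⟩

/-- The number of blocks of a pairing. -/
def blockCount {k : ℕ} (σ : Fin k → Fin k) : ℕ := (Finset.univ.filter fun j => j < σ j).card

/-- The involution exchanges left and right endpoints of blocks. -/
theorem two_mul_blockCount {k : ℕ} {σ : Fin k → Fin k} (hσ : σ ∈ NC2 k) :
    2 * blockCount σ = k := by
  obtain ⟨inv, ne, -⟩ := mem_NC2.1 hσ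
  have h := Finset.card_filter_add_card_filter_not (s := (Finset.univ : Finset (Fin k)))
    (fun j => j < σ j)
  have h2 : (Finset.univ.filter fun j => ¬ j < σ j).card = blockCount σ := by
    refine Finset.card_bij (fun j _ => σ j) (fun j hj => ?_) (fun i _ j _ hij => ?_)
      (fun j hj => ⟨σ j, ?_, inv j⟩)
    · have := ne j
      simp only [Finset.mem_filter, Finset.mem_univ, true_and, inv] at hj ⊢
      omega
    · rw [← inv i, hij, inv]
    · simp only [Finset.mem_filter, Finset.mem_univ, true_and, inv] at hj ⊢
      omega
  rw [h2, Finset.card_univ, Fintype.card_fin] at h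
  unfold blockCount at *
  omega

theorem NC2_eq_empty_of_odd {k : ℕ} (hk : ¬ Even k) : NC2 k = ∅ := by
  refine Finset.eq_empty_of_forall_notMem fun σ hσ => hk ?_
  exact ⟨blockCount σ, by rw [← two_mul, two_mul_blockCount hσ]⟩

theorem prod_fin_add_succ {M : Type*} [CommMonoid M] (f : Fin ((m + 1) + (l + 1)) → M) :
    ∏ i, f i = (f (Fin.castAdd (l + 1) 0) * ∏ i : Fin m, f (Fin.castAdd (l + 1) i.succ)) *
      (f (Fin.natAdd (m + 1) 0) * ∏ i : Fin l, f (Fin.natAdd (m + 1) i.succ)) := by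
  rw [Fin.prod_univ_add, Fin.prod_univ_succ, Fin.prod_univ_succ]

theorem sum_fin_add_succ {M : Type*} [AddCommMonoid M] (f : Fin ((m + 1) + (l + 1)) → M) :
    ∑ i, f i = (f (Fin.castAdd (l + 1) 0) + ∑ i : Fin m, f (Fin.castAdd (l + 1) i.succ)) +
      (f (Fin.natAdd (m + 1) 0) + ∑ i : Fin l, f (Fin.natAdd (m + 1) i.succ)) := by
  rw [Fin.sum_univ_add, Fin.sum_univ_succ, Fin.sum_univ_succ]

/-- The first block covers itself and every block of `σ`, which gives the new factor; any other
block covers only blocks from its own side. -/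
theorem treeFactorial_joinPairing :
    treeFactorial (joinPairing σ τ) = (blockCount σ + 1) * treeFactorial σ * treeFactorial τ := by
  simp only [treeFactorial, blockCount, Finset.prod_filter, Finset.card_filter, prod_fin_add_succ,
    sum_fin_add_succ, joinPairing_zero, joinPairing_inner, joinPairing_mid, joinPairing_outer,
    Fin.lt_def, Fin.le_def, Fin.val_castAdd, Fin.val_natAdd, Fin.val_succ, Fin.val_zero]
  have e1 : ∀ i j : Fin m, (i:ℕ) + 1 < j + 1 ↔ (i:ℕ) < j := fun i j => by omega
  have e2 : ∀ i j : Fin m, (i:ℕ) + 1 ≤ j + 1 ↔ (i:ℕ) ≤ j := fun i j => by omega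
  have e3 : ∀ i j : Fin l, m + 1 + ((i:ℕ) + 1) < m + 1 + (j + 1) ↔ (i:ℕ) < j :=
    fun i j => by omega
  have e4 : ∀ i j : Fin l, m + 1 + ((i:ℕ) + 1) ≤ m + 1 + (j + 1) ↔ (i:ℕ) ≤ j :=
    fun i j => by omega
  have e5 : ∀ i : Fin m, (i:ℕ) + 1 ≤ m + 1 := fun i => by omega
  have e6 : ∀ i : Fin l, ¬ m + 1 + ((i:ℕ) + 1) ≤ m + 1 := fun i => by omega
  have e7 : ∀ i : Fin m, ¬ m + 1 ≤ (i:ℕ) + 1 := fun i => by omega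
  have e8 : ∀ (j : Fin l) (i : Fin m), ¬ m + 1 + ((j:ℕ) + 1) ≤ (i:ℕ) + 1 := fun j i => by omega
  simp [e1, e2, e3, e4, e5, e6, e7, e8, add_comm]

end join

/-- Used to recognize the inner and outer subwords of a joined pairing, which start at positions `1`
and `m + 2`, as nested words of `σ` and `τ`. -/
theorem nestedWord_shift {R : Type*} [Mul R] (η : R → R) (d : ℕ) (p q : ℕ → ℕ) (b : ℕ → R)
    (hi lo : ℕ) (h : ∀ i, lo ≤ i → i < hi → p (i + d) = q i + d) :
    nestedWord η p b (lo + d) (hi + d) = nestedWord η q (fun i => b (i + d)) lo hi := by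
  induction hn : hi - lo using Nat.strong_induction_on generalizing lo hi with
  | _ n ih =>
    subst hn
    rw [nestedWord.eq_1 η p, nestedWord.eq_1 η q]
    by_cases hlt : lo < hi
    · rw [h lo le_rfl hlt]
      by_cases hc : lo < q lo ∧ q lo < hi
      · have hc' : lo + d < q lo + d ∧ q lo + d < hi + d := by omega
        rw [dif_pos hc, dif_pos hc']
        have i1 := ih (q lo - (lo + 1)) (by omega) (q lo) (lo + 1)
          (fun i h1 h2 => h i (by omega) (by omega)) rfl
        have i2 := ih (hi - (q lo + 1)) (by omega) hi (q lo + 1)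
          (fun i h1 h2 => h i (by omega) (by omega)) rfl
        rw [show lo + d + 1 = lo + 1 + d by omega, i1, show q lo + d + 1 = q lo + 1 + d by omega,
          i2]
      · have hc' : ¬ (lo + d < q lo + d ∧ q lo + d < hi + d) := by omega
        rw [dif_neg hc, dif_neg hc']
    · rw [dif_neg (by omega), dif_neg (by omega)]

theorem nestedValue_joinPairing {R : Type*} [Mul R] (η : R → R) {m l : ℕ} (σ : Fin m → Fin m)
    (τ : Fin l → Fin l) (b : ℕ → R) :
    nestedValue η (joinPairing σ τ) b = b 0 * η (nestedValue η σ fun i => b (i + 1)) *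
      nestedValue η τ fun i => b (i + (m + 2)) := by
  unfold nestedValue
  have h0 : ∀ h : 0 < (m + 1) + (l + 1), ((joinPairing σ τ ⟨0, h⟩ : Fin _) : ℕ) = m + 1 := by
    intro h
    exact congrArg Fin.val (joinPairing_zero σ τ)
  rw [nestedWord]
  simp only [show 0 < m + 1 + (l + 1) by omega, dite_true, h0]
  rw [dif_pos ⟨by omega, by omega⟩]
  congr 1
  · congr 2
    have := nestedWord_shift η 1 (fun i => if h : i < m + 1 + (l + 1) then
      ((joinPairing σ τ ⟨i, h⟩ : Fin _) : ℕ) else i) (fun i => if h : i < m then (σ ⟨i, h⟩ : ℕ)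
        else i) b m 0 (fun i _ h2 => by
          have := congrArg Fin.val (joinPairing_inner σ τ ⟨i, h2⟩)
          simp only [Fin.castAdd, Fin.castLE, Fin.succ_mk] at this
          rw [dif_pos (by omega), dif_pos h2, this, Fin.val_succ])
    simpa using this
  · have := nestedWord_shift η (m + 2) (fun i => if h : i < m + 1 + (l + 1) then
      ((joinPairing σ τ ⟨i, h⟩ : Fin _) : ℕ) else i) (fun i => if h : i < l then (τ ⟨i, h⟩ : ℕ)
        else i) b l 0 (fun i _ h2 => by
          have := congrArg Fin.val (joinPairing_outer σ τ ⟨i, h2⟩)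
          simp only [Fin.natAdd, Fin.succ_mk] at this
          have e : i + (m + 2) = m + 1 + (i + 1) := by omega
          simp only [Fin.val_succ] at this
          rw [dif_pos (by omega), dif_pos h2]
          simp only [e, this]
          omega)
    generalize (fun i => if h : i < m + 1 + (l + 1) then
      ((joinPairing σ τ ⟨i, h⟩ : Fin _) : ℕ) else i) = p at this ⊢
    rw [zero_add] at this
    rw [show m + 1 + (l + 1) = l + (m + 2) by omega]
    exact this

/-- The weighted sum over noncrossing pairings that gives the arcsine moments. -/
noncomputable def arcsineSum {R : Type*} [Ring R] [Algebra ℂ R] (η : R → R) (k : ℕ)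
    (b : ℕ → R) : R :=
  ∑ σ ∈ NC2 k, ((treeFactorial σ : ℂ)⁻¹) • nestedValue η σ b

theorem sum_NC2_fiber {M : Type*} [AddCommMonoid M] (m l : ℕ)
    (f : (Fin ((m + 1) + (l + 1)) → Fin ((m + 1) + (l + 1))) → M) :
    ∑ ρ ∈ (NC2 ((m + 1) + (l + 1))).filter (fun ρ => ∃ h, (ρ ⟨0, h⟩ : ℕ) = m + 1), f ρ =
      ∑ σ ∈ NC2 m, ∑ τ ∈ NC2 l, f (joinPairing σ τ) := by
  rw [← Finset.sum_product']
  symm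
  refine Finset.sum_bij (fun q _ => joinPairing q.1 q.2) ?_ ?_ ?_ ?_
  · intro q hq
    rw [Finset.mem_product] at hq
    refine Finset.mem_filter.2 ⟨(joinPairing_mem_NC2 _ _).2 hq, by omega, ?_⟩
    exact congrArg Fin.val (joinPairing_zero q.1 q.2)
  · intro q _ q' _ h
    exact Prod.ext (joinPairing_injective h).1 (joinPairing_injective h).2
  · intro ρ hρ
    obtain ⟨hρ, h, h0⟩ := Finset.mem_filter.1 hρ
    obtain ⟨σ, τ, rfl⟩ := exists_joinPairing_eq hρ h0
    exact ⟨(σ, τ), Finset.mem_product.2 ((joinPairing_mem_NC2 _ _).1 hρ), rfl⟩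
  · intro _ _
    rfl

/-- Pairings are sorted by the partner of the first point. With `m` points under its arc, the tree
factorial gains the factor `m / 2 + 1`, whose reciprocal is `2 / (m + 2)`. -/
theorem arcsineSum_add_two {R : Type*} [Ring R] [Algebra ℂ R] (η : R →ₗ[ℂ] R) (k : ℕ)
    (b : ℕ → R) :
    arcsineSum η (k + 2) b = ∑ q ∈ Finset.HasAntidiagonal.antidiagonal k, (2 / (q.1 + 2) : ℂ) •
      (b 0 * η (arcsineSum η q.1 fun i => b (i + 1)) *
        arcsineSum η q.2 fun i => b (i + (q.1 + 2))) := by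
  have hfib : ∀ N m : ℕ, ∀ l, N = (m + 1) + (l + 1) →
      ∑ ρ ∈ (NC2 N).filter (fun ρ => ∃ h, (ρ ⟨0, h⟩ : ℕ) = m + 1),
        ((treeFactorial ρ : ℂ)⁻¹) • nestedValue η ρ b =
      (2 / (m + 2) : ℂ) • (b 0 * η (arcsineSum η m fun i => b (i + 1)) *
        arcsineSum η l fun i => b (i + (m + 2))) := by
    rintro N m l rfl
    rw [sum_NC2_fiber]
    simp only [arcsineSum, map_sum, map_smul, Finset.mul_sum, Finset.sum_mul, Finset.smul_sum]
    rw [Finset.sum_comm]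
    refine Finset.sum_congr rfl fun τ hτ => Finset.sum_congr rfl fun σ hσ => ?_
    rw [treeFactorial_joinPairing, nestedValue_joinPairing]
    simp only [mul_smul_comm, smul_mul_assoc, smul_smul]
    congr 1
    have hm : (m : ℂ) = 2 * blockCount σ := by exact_mod_cast (two_mul_blockCount hσ).symm
    have : (blockCount σ : ℂ) + 1 ≠ 0 := Nat.cast_add_one_ne_zero _
    rw [hm]
    push_cast
    rw [mul_inv, mul_inv, show (2 * (blockCount σ : ℂ) + 2) = 2 * (blockCount σ + 1) by ring]
    field_simp
  rw [arcsineSum]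
  -- The fibre index is the number of inner points; the truncated subtraction is exact because `ρ 0
  -- ≠ 0`.
  have hmaps : ∀ ρ ∈ NC2 (k + 2), (ρ 0 : ℕ) - 1 ∈ Finset.range (k + 1) := by
    intro ρ _
    have := (ρ 0).2
    rw [Finset.mem_range]
    omega
  rw [← Finset.sum_fiberwise_of_maps_to hmaps, Finset.Nat.sum_antidiagonal_eq_sum_range_succ_mk]
  refine Finset.sum_congr rfl fun m hm => ?_
  rw [Finset.mem_range] at hm
  rw [← hfib (k + 2) m (k - m) (by omega)]
  refine Finset.sum_congr (Finset.filter_congr fun ρ hρ => ?_) fun _ _ => rfl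
  have h1 : ρ 0 ≠ 0 := (mem_NC2.1 hρ).2.1 0
  have h2 : (ρ 0 : ℕ) ≠ 0 := fun h => h1 (Fin.ext h)
  constructor
  · intro h
    refine ⟨by omega, ?_⟩
    change (ρ 0 : ℕ) = _
    omega
  · rintro ⟨_, h⟩
    change (ρ 0 : ℕ) = _ at h
    omega

/-! ### Elements with positive imaginary part -/

section HalfPlane

variable {𝒜 : Type*} [CStarAlgebra 𝒜]

theorem coe_imaginaryPart_eq (y : 𝒜) : (ℑ y : 𝒜) = (-(Complex.I / 2)) • (y - star y) := by
  rw [imaginaryPart_apply_coe, ← Complex.coe_smul, smul_smul]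
  congr 1
  push_cast
  ring

theorem mul_imaginaryPart_mul_star {y R : 𝒜} (h : R * y = 1) :
    R * ℑ y * star R = -(ℑ R : 𝒜) := by
  have h' : star y * star R = 1 := by rw [← star_mul, h, star_one]
  rw [coe_imaginaryPart_eq, coe_imaginaryPart_eq, mul_smul_comm, smul_mul_assoc, ← smul_neg,
    mul_sub, sub_mul, h, mul_assoc, h', one_mul, mul_one, neg_sub]

theorem star_mul_imaginaryPart_mul {y R : 𝒜} (h : y * R = 1) :
    star R * ℑ y * R = -(ℑ R : 𝒜) := by
  have h' : star R * star y = 1 := by rw [← star_mul, h, star_one]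
  rw [coe_imaginaryPart_eq, coe_imaginaryPart_eq, mul_smul_comm, smul_mul_assoc, ← smul_neg,
    mul_sub, sub_mul, h', mul_assoc, h, one_mul, mul_one, neg_sub]

variable [PartialOrder 𝒜] [StarOrderedRing 𝒜]

/-- The element `w = -i y` has real part at least `ε`, so `‖1 - t w‖ < 1` for small `t > 0`, and `t
w` is invertible by the Neumann series. -/
theorem isUnit_of_le_imaginaryPart {y : 𝒜} {ε : ℝ} (hε : 0 < ε)
    (hy : algebraMap ℝ 𝒜 ε ≤ ℑ y) : IsUnit y := by
  set w : 𝒜 := (-Complex.I) • y with hw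
  have hsum : w + star w = (2 : ℝ) • (ℑ y : 𝒜) := by
    rw [coe_imaginaryPart_eq, ← Complex.coe_smul, smul_smul, hw, star_smul]
    simp only [RCLike.star_def, map_neg, Complex.conj_I]
    rw [smul_sub, sub_eq_add_neg, ← neg_smul]
    push_cast
    congr 2 <;> ring
  -- Chosen so that `t² ‖w‖² ≤ t ε`, which is less than the gain `2 t ε`.
  set t : ℝ := ε / (‖w‖ ^ 2 + 1) with ht
  have ht0 : 0 < t := by positivity
  have hle : star (1 - t • w) * (1 - t • w) ≤
      algebraMap ℝ 𝒜 (1 - 2 * t * ε + t ^ 2 * ‖w‖ ^ 2) := by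
    have e : star (1 - t • w) * (1 - t • w) = 1 - t • (w + star w) + t ^ 2 • (star w * w) := by
      rw [star_sub, star_smul, star_one, star_trivial]
      simp only [sub_mul, mul_sub, one_mul, mul_one, smul_mul_smul_comm, smul_add]
      rw [pow_two]
      abel
    rw [e, hsum, map_add, map_sub, map_one, smul_smul]
    have h1 : algebraMap ℝ 𝒜 (2 * t * ε) ≤ (t * 2) • (ℑ y : 𝒜) := by
      rw [show 2 * t * ε = (t * 2) * ε by ring, map_mul, ← Algebra.smul_def]
      exact smul_le_smul_of_nonneg_left hy (by positivity)
    have h2 : t ^ 2 • (star w * w) ≤ algebraMap ℝ 𝒜 (t ^ 2 * ‖w‖ ^ 2) := by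
      rw [map_mul, ← Algebra.smul_def]
      exact smul_le_smul_of_nonneg_left CStarAlgebra.star_mul_le_algebraMap_norm_sq (by positivity)
    exact add_le_add (sub_le_sub_left h1 _) h2
  have hr : 1 - 2 * t * ε + t ^ 2 * ‖w‖ ^ 2 < 1 := by
    have h1 : t * (‖w‖ ^ 2 + 1) = ε := by rw [ht]; field_simp
    have h2 : t ^ 2 * ‖w‖ ^ 2 ≤ t * ε := by
      nlinarith [sq_nonneg t]
    nlinarith [mul_pos ht0 hε]
  have hnorm : ‖1 - t • w‖ < 1 := by
    rcases le_or_gt 0 (1 - 2 * t * ε + t ^ 2 * ‖w‖ ^ 2) with h0 | h0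
    · have := (CStarAlgebra.norm_le_iff_le_algebraMap _ h0 (star_mul_self_nonneg _)).2 hle
      rw [CStarRing.norm_star_mul_self] at this
      nlinarith [norm_nonneg (1 - t • w)]
    · have h3 : star (1 - t • w) * (1 - t • w) ≤ algebraMap ℝ 𝒜 0 :=
        hle.trans (algebraMap_mono _ h0.le)
      have := (CStarAlgebra.norm_le_iff_le_algebraMap _ le_rfl (star_mul_self_nonneg _)).2 h3
      rw [CStarRing.norm_star_mul_self] at this
      nlinarith [norm_nonneg (1 - t • w)]
  have hu : IsUnit (t • w) := by
    have := isUnit_one_sub_of_norm_lt_one hnorm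
    rwa [sub_sub_cancel] at this
  have hc : t • w = ((t : ℂ) * -Complex.I) • y := by rw [hw, ← Complex.coe_smul, smul_smul]
  have hne : (t : ℂ) * -Complex.I ≠ 0 :=
    mul_ne_zero (by exact_mod_cast ht0.ne') (neg_ne_zero.2 Complex.I_ne_zero)
  rw [hc] at hu
  exact (isUnit_smul_iff (Units.mk0 _ hne) y).1 hu

/-- From `R⋆ (Im y) R = -Im R` one gets `ε R⋆R ≤ -Im R`, hence `ε ‖R‖² ≤ ‖R‖`. -/
theorem norm_inverse_le_of_le_imaginaryPart {y : 𝒜} {ε : ℝ} (hε : 0 < ε)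
    (hy : algebraMap ℝ 𝒜 ε ≤ ℑ y) : ‖Ring.inverse y‖ ≤ 1 / ε := by
  set R := Ring.inverse y with hR
  have h1 : y * R = 1 := Ring.mul_inverse_cancel _ (isUnit_of_le_imaginaryPart hε hy)
  have h2 := star_left_conjugate_le_conjugate hy R
  rw [star_mul_imaginaryPart_mul h1, ← Algebra.commutes, mul_assoc, ← Algebra.smul_def] at h2
  have h3 := CStarAlgebra.norm_le_norm_of_nonneg_of_le
    (smul_nonneg hε.le (star_mul_self_nonneg R)) h2
  rw [norm_smul, CStarRing.norm_star_mul_self, norm_neg, Real.norm_of_nonneg hε.le] at h3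
  have h4 := h3.trans (imaginaryPart.norm_le R)
  rcases (norm_nonneg R).eq_or_lt with h0 | h0
  · rw [← h0]; positivity
  · rw [le_div_iff₀ hε]
    nlinarith

/-- Inverses of elements in the half plane depend Lipschitz continuously on the element. -/
theorem inverse_sub_inverse {y z : 𝒜} (hy : IsUnit y) (hz : IsUnit z) :
    Ring.inverse y - Ring.inverse z = Ring.inverse y * (z - y) * Ring.inverse z := by
  rw [mul_sub, sub_mul, mul_assoc, Ring.mul_inverse_cancel _ hz, mul_one,
    Ring.inverse_mul_cancel _ hy, one_mul]

theorem norm_inverse_sub_inverse_le {y z : 𝒜} {ε : ℝ} (hε : 0 < ε)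
    (hy : algebraMap ℝ 𝒜 ε ≤ ℑ y) (hz : algebraMap ℝ 𝒜 ε ≤ ℑ z) :
    ‖Ring.inverse y - Ring.inverse z‖ ≤ 1 / ε ^ 2 * ‖y - z‖ := by
  rw [inverse_sub_inverse (isUnit_of_le_imaginaryPart hε hy) (isUnit_of_le_imaginaryPart hε hz)]
  refine (norm_mul_le _ _).trans ?_
  have h1 := norm_inverse_le_of_le_imaginaryPart hε hy
  have h2 := norm_inverse_le_of_le_imaginaryPart hε hz
  calc ‖Ring.inverse y * (z - y)‖ * ‖Ring.inverse z‖
      ≤ (1 / ε * ‖z - y‖) * (1 / ε) := by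
        gcongr
        exact (norm_mul_le _ _).trans (by gcongr)
    _ = 1 / ε ^ 2 * ‖y - z‖ := by rw [norm_sub_rev]; ring

theorem imaginaryPart_smul_real (x : 𝒜) (hx : IsSelfAdjoint x) (u : ℝ) :
    ℑ (u • x) = 0 :=
  imaginaryPart_eq_zero_iff.2 (IsSelfAdjoint.smul (IsSelfAdjoint.all u) hx)

theorem imaginaryPart_sub_smul (b : 𝒜) {x : 𝒜} (hx : IsSelfAdjoint x) (u : ℝ) :
    ℑ (b - u • x) = ℑ b := by
  rw [map_sub, imaginaryPart_smul_real x hx, sub_zero]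

/-- A strictly positive element dominates the reciprocal of the norm of its inverse. -/
theorem algebraMap_inv_norm_le [Nontrivial 𝒜] {a : 𝒜} (ha : IsStrictlyPositive a) :
    0 < ‖Ring.inverse a‖ ∧ algebraMap ℝ 𝒜 (1 / ‖Ring.inverse a‖) ≤ a := by
  have hne : Ring.inverse a ≠ 0 := fun h => by
    have := Ring.mul_inverse_cancel a ha.isUnit
    rw [h, mul_zero] at this
    exact zero_ne_one this
  have hpos : 0 < ‖Ring.inverse a‖ := norm_pos_iff.2 hne
  refine ⟨hpos, ?_⟩
  have hinv : IsStrictlyPositive (Ring.inverse a) := ha.ringInverse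
  have h1 : Ring.inverse a ≤ algebraMap ℝ 𝒜 ‖Ring.inverse a‖ :=
    hinv.nonneg.isSelfAdjoint.le_algebraMap_norm_self
  have h2 := CStarAlgebra.ringInverse_le_ringInverse h1 hinv
  rw [Ring.inverse_inverse ha.isUnit] at h2
  convert h2
  symm
  have hm : algebraMap ℝ 𝒜 ‖Ring.inverse a‖ * algebraMap ℝ 𝒜 (1 / ‖Ring.inverse a‖) = 1 := by
    rw [← map_mul, mul_one_div_cancel hpos.ne', map_one]
  have hu : IsUnit (algebraMap ℝ 𝒜 ‖Ring.inverse a‖) :=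
    (IsUnit.mk0 _ hpos.ne').map (algebraMap ℝ 𝒜)
  rw [← mul_one (Ring.inverse _), ← hm, ← mul_assoc, Ring.inverse_mul_cancel _ hu, one_mul]

end HalfPlane

/-! ### Conditional expectations -/

section CondExp

variable {𝒜 : Type*} [CStarAlgebra 𝒜] [PartialOrder 𝒜] [StarOrderedRing 𝒜]

/-- A unital positive projection with the bimodule property over its range. -/
structure IsCondExp (Φ : 𝒜 →ₗ[ℂ] 𝒜) : Prop where
  nonneg : ∀ a, 0 ≤ a → 0 ≤ Φ a
  map_one : Φ 1 = 1
  map_mul_left : ∀ a b, Φ (Φ a * b) = Φ a * Φ b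
  map_mul_right : ∀ a b, Φ (a * Φ b) = Φ a * Φ b

namespace IsCondExp

variable {Φ : 𝒜 →ₗ[ℂ] 𝒜} (hΦ : IsCondExp Φ)
include hΦ

theorem idem (a : 𝒜) : Φ (Φ a) = Φ a := by
  have := hΦ.map_mul_left a 1
  rwa [mul_one, hΦ.map_one, mul_one] at this

theorem map_fixed_mul {b : 𝒜} (hb : Φ b = b) (a : 𝒜) : Φ (b * a) = b * Φ a := by
  have := hΦ.map_mul_left b a
  rwa [hb] at this

theorem map_mul_fixed {b : 𝒜} (hb : Φ b = b) (a : 𝒜) : Φ (a * b) = Φ a * b := by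
  have := hΦ.map_mul_right a b
  rwa [hb] at this

theorem map_star (a : 𝒜) : Φ (star a) = star (Φ a) :=
  StarHomClass.map_star (PositiveLinearMap.mk₀ Φ hΦ.nonneg) a

theorem map_imaginaryPart (a : 𝒜) : Φ (ℑ a : 𝒜) = (ℑ (Φ a) : 𝒜) := by
  rw [coe_imaginaryPart_eq, coe_imaginaryPart_eq, map_smul, map_sub, hΦ.map_star]

theorem mono {a b : 𝒜} (h : a ≤ b) : Φ a ≤ Φ b := by
  rw [← sub_nonneg, ← map_sub]
  exact hΦ.nonneg _ (sub_nonneg.2 h)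

theorem map_algebraMap (r : ℝ) : Φ (algebraMap ℝ 𝒜 r) = algebraMap ℝ 𝒜 r := by
  rw [Algebra.algebraMap_eq_smul_one, ← Complex.coe_smul, map_smul, hΦ.map_one]

/-- Expand `0 ≤ Φ((a - Φ a) m (a - Φ a)⋆)`: the bimodule property turns both mixed terms into `Φ a m
(Φ a)⋆`. Positivity of `Φ` suffices. -/
theorem schwarz {m : 𝒜} (hm : Φ m = m) (hm0 : 0 ≤ m) (a : 𝒜) :
    Φ a * m * star (Φ a) ≤ Φ (a * m * star a) := by
  have h := hΦ.nonneg _ (star_right_conjugate_nonneg hm0 (a - Φ a))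
  have h1 : Φ (a * m * star (Φ a)) = Φ a * m * star (Φ a) := by
    rw [← hΦ.map_star, hΦ.map_mul_right, hΦ.map_mul_fixed hm]
  have h2 : Φ (Φ a * m * star a) = Φ a * m * star (Φ a) := by
    rw [mul_assoc, hΦ.map_mul_left, hΦ.map_fixed_mul hm, hΦ.map_star, mul_assoc]
  have h3 : Φ (Φ a * m * star (Φ a)) = Φ a * m * star (Φ a) := by
    rw [mul_assoc, hΦ.map_mul_left, hΦ.map_fixed_mul hm, ← hΦ.map_star, hΦ.idem]
  rw [star_sub, sub_mul, sub_mul, mul_sub, mul_sub, map_sub, map_sub, map_sub, h1, h2, h3,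
    sub_self, sub_zero] at h
  exact sub_nonneg.1 h

theorem norm_map_le (a : 𝒜) : ‖Φ a‖ ≤ ‖a‖ := by
  have h := hΦ.schwarz hΦ.map_one zero_le_one a
  rw [mul_one, mul_one] at h
  have h2 := hΦ.mono (CStarAlgebra.mul_star_le_algebraMap_norm_sq (a := a))
  rw [hΦ.map_algebraMap] at h2
  have h3 := (CStarAlgebra.norm_le_iff_le_algebraMap _ (sq_nonneg _) (mul_star_self_nonneg _)).2
    (h.trans h2)
  rw [CStarRing.norm_self_mul_star, ← pow_two] at h3
  exact le_of_sq_le_sq h3 (norm_nonneg _)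

/-- The inverse of an element of the range lies in the range. -/
theorem map_inverse {b : 𝒜} (hb : Φ b = b) (hu : IsUnit b) :
    Φ (Ring.inverse b) = Ring.inverse b := by
  have h := hΦ.map_fixed_mul hb (Ring.inverse b)
  rw [Ring.mul_inverse_cancel _ hu, hΦ.map_one] at h
  rw [← one_mul (Φ _), ← Ring.inverse_mul_cancel _ hu, mul_assoc, ← h, mul_one]

variable {x : 𝒜} (hx : IsSelfAdjoint x)

theorem neg_imaginaryPart_cauchy {R y : 𝒜} (h : R * y = 1) :
    Φ (R * ℑ y * star R) = -(ℑ (Φ R) : 𝒜) := by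
  rw [mul_imaginaryPart_mul_star h, map_neg, hΦ.map_imaginaryPart]

/-- The compression of a resolvent is invertible, and its inverse has a larger imaginary part. -/
theorem cauchy_spec {b y : 𝒜} {ε : ℝ} (hε : 0 < ε) (hb : Φ b = b)
    (hbε : algebraMap ℝ 𝒜 ε ≤ ℑ b) (hy : ℑ y = ℑ b) :
    IsUnit (Φ (Ring.inverse y)) ∧ (ℑ b : 𝒜) ≤ ℑ (Ring.inverse (Φ (Ring.inverse y))) ∧
      Φ (Ring.inverse (Φ (Ring.inverse y))) = Ring.inverse (Φ (Ring.inverse y)) := by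
  have hyε : algebraMap ℝ 𝒜 ε ≤ ℑ y := by rwa [hy]
  have hyu := isUnit_of_le_imaginaryPart hε hyε
  set R := Ring.inverse y with hR
  have hRy : R * y = 1 := Ring.inverse_mul_cancel _ hyu
  have hyR : y * R = 1 := Ring.mul_inverse_cancel _ hyu
  set G := Φ R with hG
  have hneg := hΦ.neg_imaginaryPart_cauchy hRy
  have hq : Φ (ℑ b : 𝒜) = ℑ b := by rw [hΦ.map_imaginaryPart, hb]
  have hq0 : (0 : 𝒜) ≤ ℑ b := le_trans (by
    rw [← map_zero (algebraMap ℝ 𝒜)]; exact algebraMap_mono _ hε.le) hbε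
  -- Since `-Im G = Φ(R (Im b) R⋆)`, this becomes `G (Im b) G⋆ ≤ -Im G`; conjugation by `G⁻¹` will
  -- give the claimed inequality.
  have hs := hΦ.schwarz hq hq0 R
  rw [hy, ← hG] at hneg
  rw [hneg, ← hG] at hs
  -- A strictly positive lower bound for `R R⋆` puts `-G` into a half plane, so that `G` is
  -- invertible.
  have hRR : algebraMap ℝ 𝒜 (1 / (‖y‖ ^ 2 + 1)) ≤ R * star R := by
    have h1 : y * star y ≤ algebraMap ℝ 𝒜 (‖y‖ ^ 2 + 1) :=
      CStarAlgebra.mul_star_le_algebraMap_norm_sq.trans (algebraMap_mono _ (by linarith))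
    have h2 := star_right_conjugate_le_conjugate h1 R
    have e : R * (y * star y) * star R = 1 := by
      rw [← mul_assoc, hRy, one_mul, ← star_mul, hRy, star_one]
    rw [e, ← Algebra.commutes, mul_assoc, ← Algebra.smul_def] at h2
    have h3 := smul_le_smul_of_nonneg_left h2
      (show (0 : ℝ) ≤ 1 / (‖y‖ ^ 2 + 1) by positivity)
    rw [smul_smul, one_div_mul_cancel (by positivity), one_smul] at h3
    rwa [Algebra.algebraMap_eq_smul_one]
  have hlow : algebraMap ℝ 𝒜 (ε * (1 / (‖y‖ ^ 2 + 1))) ≤ -(ℑ G : 𝒜) := by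
    rw [← hneg, ← hΦ.map_algebraMap]
    refine hΦ.mono ?_
    have h1 := star_right_conjugate_le_conjugate hbε R
    rw [← Algebra.commutes, mul_assoc, ← Algebra.smul_def] at h1
    refine le_trans ?_ h1
    rw [map_mul, ← Algebra.smul_def]
    exact smul_le_smul_of_nonneg_left hRR hε.le
  have hGu : IsUnit G := by
    have : IsUnit (-G) := isUnit_of_le_imaginaryPart (ε := ε * (1 / (‖y‖ ^ 2 + 1)))
      (by positivity) (by rwa [map_neg])
    simpa using this
  have hGfix : Φ G = G := hΦ.idem R
  refine ⟨hGu, ?_, hΦ.map_inverse hGfix hGu⟩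
  set F := Ring.inverse G with hF
  have hFG : F * G = 1 := Ring.inverse_mul_cancel _ hGu
  have hGF : G * F = 1 := Ring.mul_inverse_cancel _ hGu
  have h5 := star_right_conjugate_le_conjugate hs F
  have h6 := mul_imaginaryPart_mul_star (y := G) (R := F) hFG
  rw [mul_neg, neg_mul, h6, neg_neg] at h5
  have e : F * (G * ℑ b * star G) * star F = ℑ b := by
    rw [← mul_assoc, ← mul_assoc, hFG, one_mul, mul_assoc, ← star_mul, hFG, star_one, mul_one]
  rwa [e] at h5

end IsCondExp

end CondExp

/-- The recursion for the moments `Φ(c x c x ⋯ x c)` of an arcsine element with covariance `H`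
over the range of the conditional expectation `Φ`. -/
structure IsArcsineOver {𝒜 : Type*} [CStarAlgebra 𝒜] (Φ H : 𝒜 →L[ℂ] 𝒜) (x : 𝒜) : Prop where
  selfAdjoint : IsSelfAdjoint x
  centered : ∀ c, Φ c = c → Φ (c * x * c) = 0
  moment_add_two : ∀ c, Φ c = c → ∀ k, Φ (word x (fun _ => c) (k + 2)) =
    ∑ q ∈ Finset.HasAntidiagonal.antidiagonal k, (2 / (q.1 + 2) : ℂ) •
      (c * H (Φ (word x (fun _ => c) q.1)) * Φ (word x (fun _ => c) q.2))

theorem word_congr {R : Type*} [Mul R] (x : R) {b b' : ℕ → R} :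
    ∀ {k : ℕ}, (∀ t ≤ k, b t = b' t) → word x b k = word x b' k
  | 0, h => h 0 le_rfl
  | k + 1, h => by
    rw [word, word, h (k + 1) le_rfl, word_congr x fun t ht => h t (ht.trans k.le_succ)]

/-! ### Sums over paths -/

section Path

variable {ι β V : Type*} [Fintype ι] [AddCommMonoid V]

/-- The sequence `y, b₀, b₁, …`. -/
def consSeq (y : β) (b : ℕ → β) : ℕ → β
  | 0 => y
  | n + 1 => b n

/-- The sum of `f (c i₀ i₁, c i₁ i₂, …, c iₙ iₙ₊₁)` over all paths from `i₀ = i` to `iₙ₊₁ = j`. -/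
def pathSum (c : ι → ι → β) : ℕ → ι → ι → ((ℕ → β) → V) → V
  | 0, i, j, f => f fun _ => c i j
  | n + 1, i, j, f => ∑ a, pathSum c n a j fun b => f (consSeq (c i a) b)

theorem pathSum_map {W F : Type*} [AddCommMonoid W] [FunLike F V W] [AddMonoidHomClass F V W]
    (T : F) (c : ι → ι → β) (n : ℕ) (i j : ι) (f : (ℕ → β) → V) :
    T (pathSum c n i j f) = pathSum c n i j fun b => T (f b) := by
  induction n generalizing i f with
  | zero => rfl
  | succ n ih => simp only [pathSum, map_sum, ih]

theorem pathSum_sum {κ : Type*} (s : Finset κ) (c : ι → ι → β) (n : ℕ) (i j : ι)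
    (f : κ → (ℕ → β) → V) :
    pathSum c n i j (fun b => ∑ q ∈ s, f q b) = ∑ q ∈ s, pathSum c n i j (f q) := by
  induction n generalizing i f with
  | zero => rfl
  | succ n ih =>
    simp only [pathSum, ih]
    exact Finset.sum_comm

theorem pathSum_smul [Module ℂ V] (r : ℂ) (c : ι → ι → β) (n : ℕ) (i j : ι)
    (f : (ℕ → β) → V) :
    pathSum c n i j (fun b => r • f b) = r • pathSum c n i j f :=
  (pathSum_map (LinearMap.lsmul ℂ V r) c n i j f).symm

/-- A path is cut at its vertex after `m + 1` edges. The hypothesis `hg` says that `g` sees only the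
edges before the cut, and the shift makes `h` see only those after it. -/
theorem pathSum_mul {R : Type*} [NonUnitalSemiring R] (c : ι → ι → β) (n m : ℕ) (i j : ι)
    (g h : (ℕ → β) → R) (hg : ∀ b b' : ℕ → β, (∀ t ≤ m, b t = b' t) → g b = g b') :
    pathSum c (n + m + 1) i j (fun b => g b * h fun t => b (t + (m + 1))) =
      ∑ a, pathSum c m i a g * pathSum c n a j h := by
  induction m generalizing i g with
  | zero =>
    simp only [pathSum]
    refine Finset.sum_congr rfl fun a _ => ?_
    have : ∀ b, g (consSeq (c i a) b) = g fun _ => c i a := fun b => hg _ _ fun t ht => by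
      rw [Nat.le_zero.1 ht]
      rfl
    simp only [this]
    exact (pathSum_map (AddMonoidHom.mulLeft (g fun _ => c i a)) c n a j h).symm
  | succ m ih =>
    rw [show n + (m + 1) + 1 = (n + m + 1) + 1 by rfl, pathSum]
    have : ∀ a', pathSum c (n + m + 1) a' j (fun b => g (consSeq (c i a') b) *
        h fun t => b (t + (m + 1))) =
        ∑ a, pathSum c m a' a (fun b => g (consSeq (c i a') b)) * pathSum c n a j h := fun a' =>
      ih a' (fun b => g (consSeq (c i a') b)) fun b b' hb => hg _ _ fun t ht => by
        cases t with
        | zero => rfl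
        | succ t => exact hb t (by omega)
    refine (Finset.sum_congr rfl fun a' _ => this a').trans ?_
    rw [Finset.sum_comm]
    simp only [pathSum, Finset.sum_mul]

end Path

/-! ### From arcsine elements to the moment recursion -/

section Moments

variable {A : Type*} [CStarAlgebra A] [PartialOrder A] [StarOrderedRing A]
  {B : StarSubalgebra ℂ A} {E : A →CP A}

theorem IsOVProbabilitySpace.isCondExp (hE : IsOVProbabilitySpace B E) :
    IsCondExp (E : A →ₗ[ℂ] A) where
  nonneg a ha := map_nonneg E ha
  map_one := hE.map_of_mem 1 (one_mem B)
  map_mul_left a b := by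
    have := hE.map_bimodule (E a) (hE.map_mem a) 1 (one_mem B) b
    simpa using this
  map_mul_right a b := by
    have := hE.map_bimodule 1 (one_mem B) (E b) (hE.map_mem b) a
    simpa using this

/-- Complete positivity enters here, making the entrywise map positive on matrices. -/
theorem IsOVProbabilitySpace.isCondExp_map (hE : IsOVProbabilitySpace B E) (k : ℕ) :
    IsCondExp (CStarMatrix.mapₗ (m := Fin k) (n := Fin k) (E : A →ₗ[ℂ] A)) where
  nonneg M hM := CompletelyPositiveMapClass.map_cstarMatrix_nonneg' E k M hM
  map_one := by
    ext i j
    have : (CStarMatrix.mapₗ (E : A →ₗ[ℂ] A) (1 : CStarMatrix (Fin k) (Fin k) A)) i j =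
      E ((1 : CStarMatrix (Fin k) (Fin k) A) i j) := rfl
    rw [this, CStarMatrix.one_apply]
    split_ifs
    · exact hE.isCondExp.map_one
    · exact map_zero E
  map_mul_left M N := by
    ext i j
    change E ((_ * N : CStarMatrix _ _ A) i j) = (_ * _ : CStarMatrix _ _ A) i j
    rw [CStarMatrix.mul_apply, CStarMatrix.mul_apply, map_sum]
    exact Finset.sum_congr rfl fun l _ => hE.isCondExp.map_mul_left (M i l) (N l j)
  map_mul_right M N := by
    ext i j
    change E ((M * _ : CStarMatrix _ _ A) i j) = (_ * _ : CStarMatrix _ _ A) i j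
    rw [CStarMatrix.mul_apply, CStarMatrix.mul_apply, map_sum]
    exact Finset.sum_congr rfl fun l _ => hE.isCondExp.map_mul_right (M i l) (N l j)

/-- A conditional expectation as a continuous linear map. -/
def IsCondExp.toCLM {𝒜 : Type*} [CStarAlgebra 𝒜] [PartialOrder 𝒜] [StarOrderedRing 𝒜]
    {Φ : 𝒜 →ₗ[ℂ] 𝒜} (hΦ : IsCondExp Φ) : 𝒜 →L[ℂ] 𝒜 :=
  Φ.mkContinuous 1 fun a => by rw [one_mul]; exact hΦ.norm_map_le a

/-- The covariance map composed with the conditional expectation. -/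
def covariance (hE : IsOVProbabilitySpace B E) (η : B →L[ℂ] B) : A →L[ℂ] A :=
  LinearMap.mkContinuous
    { toFun := fun a => (η ⟨E a, hE.map_mem a⟩ : B)
      map_add' := fun a b => by
        have : (⟨E (a + b), hE.map_mem _⟩ : B) = ⟨E a, hE.map_mem a⟩ + ⟨E b, hE.map_mem b⟩ :=
          Subtype.ext (map_add E a b)
        rw [this, map_add]
        rfl
      map_smul' := fun r a => by
        have : (⟨E (r • a), hE.map_mem _⟩ : B) = r • ⟨E a, hE.map_mem a⟩ :=
          Subtype.ext (map_smul E r a)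
        rw [this, map_smul]
        rfl } ‖η‖ fun a =>
    (η.le_opNorm _).trans
      (mul_le_mul_of_nonneg_left (hE.isCondExp.norm_map_le a) (norm_nonneg η))

theorem covariance_apply (hE : IsOVProbabilitySpace B E) (η : B →L[ℂ] B) (a : A) :
    covariance hE η a = (η ⟨E a, hE.map_mem a⟩ : B) := rfl

theorem norm_covariance_sub_le (hE : IsOVProbabilitySpace B E) (η η' : B →L[ℂ] B) (a : A) :
    ‖covariance hE η a - covariance hE η' a‖ ≤ ‖η - η'‖ * ‖a‖ :=
  ((η - η').le_opNorm ⟨E a, hE.map_mem a⟩).trans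
    (mul_le_mul_of_nonneg_left (hE.isCondExp.norm_map_le a) (norm_nonneg _))

variable {η : B →L[ℂ] B} {x : A}

/-- The case distinction on parity disappears because an odd number of points has no pairing. -/
theorem IsArcsineElement.moment_eq (h : IsArcsineElement B E η x) (k : ℕ) (b : ℕ → B) :
    E (word x (fun i => (b i : A)) k) = (arcsineSum η k b : B) := by
  rw [h.moments]
  split_ifs with hk
  · rfl
  · rw [arcsineSum, NC2_eq_empty_of_odd hk, Finset.sum_empty]
    rfl

/-- The shift by `q.1 + 2` is written as `q.1 + 1` followed by `1`, matching the two cuts made with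
`pathSum_mul` in the matrix case. -/
theorem IsArcsineElement.moment_add_two (hE : IsOVProbabilitySpace B E)
    (h : IsArcsineElement B E η x) (k : ℕ) (b : ℕ → B) :
    E (word x (fun i => (b i : A)) (k + 2)) =
      ∑ q ∈ Finset.HasAntidiagonal.antidiagonal k, (2 / (q.1 + 2) : ℂ) •
        ((b 0 : A) * (covariance hE η (E (word x (fun i => (b (i + 1) : A)) q.1)) *
          E (word x (fun i => (b (i + (q.1 + 1) + 1) : A)) q.2))) := by
  have e := arcsineSum_add_two (η : B →ₗ[ℂ] B) k b
  rw [h.moment_eq]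
  refine (congrArg (Subtype.val : B → A) e).trans ?_
  rw [AddSubmonoidClass.coe_finsetSum]
  refine Finset.sum_congr rfl fun q _ => ?_
  rw [covariance_apply]
  have e1 : (⟨E (E (word x (fun i => (b (i + 1) : A)) q.1)), hE.map_mem _⟩ : B) =
      arcsineSum η q.1 fun i => b (i + 1) := by
    refine Subtype.ext ?_
    have := h.moment_eq q.1 fun i => b (i + 1)
    change E (E _) = _
    rw [this, hE.map_of_mem _ (SetLike.coe_mem _)]
  have e2 : (fun i => b (i + (q.1 + 1) + 1)) = fun i => b (i + (q.1 + 2)) := by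
    funext i
    congr 1
  have e3 := h.moment_eq q.2 fun i => b (i + (q.1 + 1) + 1)
  rw [e1, e3, e2, ← mul_assoc]
  rfl

theorem IsArcsineElement.isArcsineOver (hE : IsOVProbabilitySpace B E)
    (hx : IsSelfAdjoint x) (h : IsArcsineElement B E η x) :
    IsArcsineOver hE.isCondExp.toCLM (covariance hE η) x where
  selfAdjoint := hx
  centered c hc := by
    have hc' : E c = c := hc
    have hcB : c ∈ B := hc' ▸ hE.map_mem c
    change E (c * x * c) = 0
    rw [hE.map_bimodule c hcB c hcB, h.centered, mul_zero, zero_mul]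
  moment_add_two c hc k := by
    have hc' : E c = c := hc
    have hcB : c ∈ B := hc' ▸ hE.map_mem c
    refine (h.moment_add_two hE k fun _ => ⟨c, hcB⟩).trans ?_
    refine Finset.sum_congr rfl fun q _ => ?_
    rw [← mul_assoc]
    rfl

theorem word_amplify {k : ℕ} (c : Fin k → Fin k → B) (n : ℕ) (i j : Fin k) :
    word (amplify k x) (fun _ => CStarMatrix.ofMatrix fun i j => (c i j : A)) n i j =
      pathSum c n i j fun b => word x (fun t => (b t : A)) n := by
  induction n generalizing j with
  | zero => rfl
  | succ n ih =>
    have := pathSum_mul c 0 n i j (fun b => word x (fun t => (b t : A)) n)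
      (fun b => x * (b 0 : A)) fun b b' hb => word_congr x fun t ht => by rw [hb t ht]
    simp only [zero_add] at this
    simp only [word, mul_assoc]
    rw [this, CStarMatrix.mul_apply]
    refine Finset.sum_congr rfl fun a _ => ?_
    rw [← ih a]
    congr 1
    rw [CStarMatrix.mul_apply]
    simp [amplify, CStarMatrix.ofMatrix_apply, Matrix.diagonal_apply, pathSum]
    rfl

theorem isSelfAdjoint_amplify (hx : IsSelfAdjoint x) (k : ℕ) : IsSelfAdjoint (amplify k x) := by
  ext i j
  rw [CStarMatrix.star_apply]
  simp only [amplify, CStarMatrix.ofMatrix_apply, Matrix.diagonal_apply]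
  by_cases hij : i = j
  · simp [hij, hx.star_eq]
  · simp [hij, Ne.symm hij]

/-- A matrix with entries of norm at most `r` has norm at most `k r`. -/
theorem norm_cstarMatrix_le {k : ℕ} (M : CStarMatrix (Fin k) (Fin k) A) {r : ℝ}
    (hM : ∀ i j, ‖M i j‖ ≤ r) : ‖M‖ ≤ k * r := by
  rcases Nat.eq_zero_or_pos k with rfl | hk
  · have : M = 0 := by ext i; exact i.elim0
    simp [this]
  have : NeZero k := ⟨hk.ne'⟩
  have hr : 0 ≤ r := (norm_nonneg _).trans (hM 0 0)
  let D : (Fin k → A) →⋆ₙₐ[ℂ] CStarMatrix (Fin k) (Fin k) A :=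
    { toFun := fun d => CStarMatrix.ofMatrix (Matrix.diagonal d)
      map_smul' := fun t d => by
        ext i j
        by_cases hij : i = j <;> simp [CStarMatrix.ofMatrix_apply, hij]
      map_zero' := by
        ext i j
        simp [CStarMatrix.ofMatrix_apply]
      map_add' := fun d e => by
        ext i j
        by_cases hij : i = j <;> simp [CStarMatrix.ofMatrix_apply, hij]
      map_mul' := fun d e => by
        ext i j
        rw [CStarMatrix.mul_apply]
        by_cases hij : i = j <;> simp [CStarMatrix.ofMatrix_apply, Matrix.diagonal_apply, hij]
      map_star' := fun d => by
        ext i j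
        rw [CStarMatrix.star_apply]
        by_cases hij : i = j
        · simp [CStarMatrix.ofMatrix_apply, hij]
        · simp [CStarMatrix.ofMatrix_apply, hij, Ne.symm hij] }
  -- Cyclic permutation matrices: `M` is the sum of its `k` cyclic diagonals, each a diagonal matrix
  -- of norm at most `r` times some `P s`.
  let P : Fin k → CStarMatrix (Fin k) (Fin k) A := fun s =>
    CStarMatrix.ofMatrix fun i j => if j = i + s then 1 else 0
  have hPa : ∀ s i j, P s i j = if j = i + s then 1 else 0 := fun _ _ _ => rfl
  have hP : ∀ s, ‖P s‖ ≤ 1 := by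
    intro s
    have h1 : P s * star (P s) = 1 := by
      ext i j
      rw [CStarMatrix.mul_apply, CStarMatrix.one_apply]
      simp [hPa, CStarMatrix.star_apply, apply_ite star, eq_comm]
    have h2 := CStarRing.norm_self_mul_star (x := P s)
    rw [h1] at h2
    have h3 : ‖(1 : CStarMatrix (Fin k) (Fin k) A)‖ ≤ 1 := by
      nontriviality CStarMatrix (Fin k) (Fin k) A
      rw [CStarRing.norm_one]
    nlinarith [norm_nonneg (P s)]
  have hsum : M = ∑ s, D (fun i => M i (i + s)) * P s := by
    ext i j
    have : (∑ s, D (fun i => M i (i + s)) * P s) i j =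
        ∑ s, (D (fun i => M i (i + s)) * P s) i j := Matrix.sum_apply i j _ _
    rw [this]
    have h4 : ∀ s, (D (fun i => M i (i + s)) * P s) i j = if j = i + s then M i (i + s) else 0 := by
      intro s
      rw [CStarMatrix.mul_apply]
      rw [Finset.sum_eq_single i]
      · simp [D, hPa, CStarMatrix.ofMatrix_apply]
      · intro l _ hl
        simp [D, CStarMatrix.ofMatrix_apply, hl.symm]
      · simp
    simp only [h4]
    rw [Finset.sum_eq_single (j - i)]
    · simp
    · intro s _ hs
      rw [if_neg]
      rintro rfl
      simp at hs
    · simp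
  rw [hsum]
  refine (norm_sum_le _ _).trans ?_
  have h5 : ∀ s ∈ Finset.univ, ‖D (fun i => M i (i + s)) * P s‖ ≤ r := fun s _ => by
    refine (norm_mul_le _ _).trans ?_
    have h6 : ‖D (fun i => M i (i + s))‖ ≤ r :=
      (NonUnitalStarAlgHom.norm_apply_le D _).trans
        ((pi_norm_le_iff_of_nonneg hr).2 fun i => hM i (i + s))
    calc _ ≤ r * 1 := mul_le_mul h6 (hP s) (norm_nonneg _) hr
      _ = r := mul_one r
  refine (Finset.sum_le_card_nsmul _ _ _ h5).trans ?_
  simp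

/-- The entrywise application of a continuous linear map to matrices. -/
def mapCLM (k : ℕ) (T : A →L[ℂ] A) :
    CStarMatrix (Fin k) (Fin k) A →L[ℂ] CStarMatrix (Fin k) (Fin k) A :=
  (CStarMatrix.mapₗ (T : A →ₗ[ℂ] A)).mkContinuous (k * ‖T‖) fun M => by
    rw [mul_assoc]
    exact norm_cstarMatrix_le _ fun i j => (T.le_opNorm _).trans
      (mul_le_mul_of_nonneg_left CStarMatrix.norm_entry_le_norm (norm_nonneg T))

/-- Matrix entries of a word are path sums of words over `B` with varying coefficients. The
recursion over `B` is multilinear in them, so it can be applied path by path and reassembled as a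
matrix product. -/
theorem IsArcsineElement.isArcsineOver_amplify (hE : IsOVProbabilitySpace B E)
    (hx : IsSelfAdjoint x) (h : IsArcsineElement B E η x) (k : ℕ) :
    IsArcsineOver (hE.isCondExp_map k).toCLM (mapCLM k (covariance hE η)) (amplify k x) where
  selfAdjoint := isSelfAdjoint_amplify hx k
  centered c hc := by
    have hc' : ∀ i j, E (c i j) = c i j := fun i j => congrFun (congrFun hc i) j
    have hcB : ∀ i j, c i j ∈ B := fun i j => hc' i j ▸ hE.map_mem _
    ext i j
    change E ((c * amplify k x * c) i j) = 0
    rw [CStarMatrix.mul_apply, map_sum]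
    refine Finset.sum_eq_zero fun l _ => ?_
    have : (c * amplify k x) i l = c i l * x := by
      rw [CStarMatrix.mul_apply]
      simp [amplify, CStarMatrix.ofMatrix_apply, Matrix.diagonal_apply]
    rw [this, hE.map_bimodule _ (hcB i l) _ (hcB l j), h.centered, mul_zero, zero_mul]
  moment_add_two c hc n := by
    have hc' : ∀ i j, E (c i j) = c i j := fun i j => congrFun (congrFun hc i) j
    have hcB : ∀ i j, c i j ∈ B := fun i j => hc' i j ▸ hE.map_mem _
    set d : Fin k → Fin k → B := fun i j => ⟨c i j, hcB i j⟩ with hd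
    have hcd : c = CStarMatrix.ofMatrix fun i j => (d i j : A) := rfl
    have hM : ∀ n i j, (hE.isCondExp_map k).toCLM (word (amplify k x) (fun _ => c) n) i j =
        pathSum d n i j fun b => E (word x (fun t => (b t : A)) n) := fun n i j => by
      rw [← pathSum_map E, ← word_amplify d n i j]
      rfl
    have hH : ∀ M i j, mapCLM k (covariance hE η) M i j = covariance hE η (M i j) :=
      fun _ _ _ => rfl
    ext i j
    rw [hM]
    simp only [h.moment_add_two hE]
    rw [pathSum_sum]
    simp only [pathSum_smul]
    refine Eq.trans ?_ (Matrix.sum_apply i j _ _).symm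
    refine Finset.sum_congr rfl fun q hq => ?_
    rw [Finset.HasAntidiagonal.mem_antidiagonal] at hq
    rw [CStarMatrix.smul_apply]
    congr 1
    -- The `n + 3` edges of a path split as `1 + (q.1 + 1) + (q.2 + 1)`: the factor `c`, the inner
    -- word and the outer word.
    have hn : n + 2 = (q.2 + q.1 + 1) + 0 + 1 := by omega
    rw [hn, mul_assoc, CStarMatrix.mul_apply]
    refine (pathSum_mul d (q.2 + q.1 + 1) 0 i j (fun b => (b 0 : A)) (fun b =>
      covariance hE η (E (word x (fun i => (b i : A)) q.1)) *
        E (word x (fun i => (b (i + (q.1 + 1)) : A)) q.2)) fun b b' hb => by rw [hb 0 le_rfl]).trans ?_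
    refine Finset.sum_congr rfl fun a _ => ?_
    congr 1
    rw [CStarMatrix.mul_apply]
    refine (pathSum_mul d q.2 q.1 a j (fun b => covariance hE η (E (word x (fun i => (b i : A)) q.1)))
      (fun b => E (word x (fun i => (b i : A)) q.2)) fun b b' hb => by
        rw [word_congr x fun t ht => by rw [hb t ht]]).trans ?_
    refine Finset.sum_congr rfl fun a' _ => ?_
    rw [hH, hM, hM, pathSum_map]

end Moments

/-! ### The differential equation for the reciprocal Cauchy transform -/

section Flow

open Filter Topology

variable {𝒜 : Type*} [CStarAlgebra 𝒜]

/-- The Cauchy transform `Φ[(b - u x)⁻¹]`. -/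
def cauchyTransform (Φ : 𝒜 →L[ℂ] 𝒜) (x : 𝒜) (u : ℝ) (b : 𝒜) : 𝒜 :=
  Φ (Ring.inverse (b - u • x))

/-- The reciprocal Cauchy transform of `√s x`. -/
def flow (Φ : 𝒜 →L[ℂ] 𝒜) (x : 𝒜) (s : ℝ) (b : 𝒜) : 𝒜 :=
  Ring.inverse (cauchyTransform Φ x √s b)

theorem norm_word_const_le (x c : 𝒜) (k : ℕ) :
    ‖word x (fun _ => c) k‖ ≤ ‖c‖ * (‖x‖ * ‖c‖) ^ k := by
  induction k with
  | zero => simp [word]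
  | succ k ih =>
    rw [word, pow_succ, ← mul_assoc, mul_assoc]
    calc ‖word x (fun _ => c) k * (x * c)‖ ≤ ‖word x (fun _ => c) k‖ * ‖x * c‖ := norm_mul_le _ _
      _ ≤ _ := mul_le_mul ih (norm_mul_le _ _) (norm_nonneg _) (by positivity)

/-- Neumann series of a resolvent, in terms of words. -/
theorem tsum_word_eq_inverse {b x : 𝒜} {u : ℝ} (hb : IsUnit b) (hbu : IsUnit (b - u • x))
    (hs : Summable fun k => u ^ k • word x (fun _ => Ring.inverse b) k) :
    ∑' k, u ^ k • word x (fun _ => Ring.inverse b) k = Ring.inverse (b - u • x) := by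
  set c := Ring.inverse b with hc
  set S := ∑' k, u ^ k • word x (fun _ => c) k with hS
  have hcb : c * b = 1 := Ring.inverse_mul_cancel _ hb
  have h1 : S * b = 1 + S * (u • x) := by
    rw [hS, ← hs.tsum_mul_right, (hs.mul_right b).tsum_eq_zero_add, ← hs.tsum_mul_right]
    congr 1
    · simp [word, hcb]
    · refine tsum_congr fun k => ?_
      rw [word, smul_mul_assoc, mul_assoc, hcb, mul_one, pow_succ, smul_mul_smul_comm]
  have h2 : S * (b - u • x) = 1 := by rw [mul_sub, h1, add_sub_cancel_right]
  rw [← mul_one S, ← Ring.mul_inverse_cancel _ hbu, ← mul_assoc, h2, one_mul]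

variable [PartialOrder 𝒜] [StarOrderedRing 𝒜]

variable {Φ H : 𝒜 →L[ℂ] 𝒜} {x b : 𝒜} {ε : ℝ}

theorem le_imaginaryPart_sub_smul (hx : IsSelfAdjoint x) (hb : algebraMap ℝ 𝒜 ε ≤ ℑ b) (u : ℝ) :
    algebraMap ℝ 𝒜 ε ≤ ℑ (b - u • x) := by
  rwa [imaginaryPart_sub_smul b hx]

theorem cauchyTransform_spec (hΦ : IsCondExp (Φ : 𝒜 →ₗ[ℂ] 𝒜)) (hx : IsSelfAdjoint x)
    (hε : 0 < ε) (hb : Φ b = b) (hbε : algebraMap ℝ 𝒜 ε ≤ ℑ b) (u : ℝ) :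
    IsUnit (cauchyTransform Φ x u b) ∧
      (ℑ b : 𝒜) ≤ ℑ (Ring.inverse (cauchyTransform Φ x u b)) ∧
      Φ (Ring.inverse (cauchyTransform Φ x u b)) = Ring.inverse (cauchyTransform Φ x u b) :=
  hΦ.cauchy_spec hε hb hbε (imaginaryPart_sub_smul b hx u)

/-- For small `u` the moment series converges and the recursion, a Cauchy product, reads `G = c + c
T G` with `c = b⁻¹`. Hence `G⁻¹ = b - T`, and `T` is differentiated termwise. -/
theorem hasDerivAt_inverse_cauchyTransform_of_small (hΦ : IsCondExp (Φ : 𝒜 →ₗ[ℂ] 𝒜))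
    (hx : IsArcsineOver Φ H x) (hε : 0 < ε) (hb : Φ b = b) (hbε : algebraMap ℝ 𝒜 ε ≤ ℑ b) :
    ∃ r > 0, ∀ u : ℝ, |u| < r → HasDerivAt (fun u => Ring.inverse (cauchyTransform Φ x u b))
      (-((2 * u) • H (cauchyTransform Φ x u b))) u := by
  have hbu := isUnit_of_le_imaginaryPart hε hbε
  set c := Ring.inverse b with hc
  have hcΦ : Φ c = c := hΦ.map_inverse hb hbu
  set m : ℕ → 𝒜 := fun k => Φ (word x (fun _ => c) k) with hm
  have hm0 : m 0 = c := hcΦ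
  have hm1 : m 1 = 0 := hx.centered c hcΦ
  set ρ := ‖x‖ * ‖c‖ with hρ
  have hρ0 : 0 ≤ ρ := by positivity
  have hw : ∀ k, ‖word x (fun _ => c) k‖ ≤ ‖c‖ * ρ ^ k := norm_word_const_le x c
  have hmn : ∀ k, ‖m k‖ ≤ ‖c‖ * ρ ^ k := fun k => (hΦ.norm_map_le _).trans (hw k)
  -- Ensures both `|u| ρ ≤ 1/2`, for geometric convergence, and `|u| ≤ 1`.
  set r : ℝ := 1 / (2 * (ρ + 1)) with hr
  have hr0 : 0 < r := by positivity
  have hr1 : r ≤ 1 := by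
    rw [hr, div_le_one (by positivity)]
    linarith
  have hgeom : ∀ u : ℝ, |u| < r → ∀ k, |u| ^ k * ρ ^ k ≤ (1 / 2) ^ k := by
    intro u hu k
    rw [← mul_pow]
    refine pow_le_pow_left₀ (by positivity) ?_ k
    calc |u| * ρ ≤ r * (ρ + 1) := by (gcongr; linarith)
      _ = 1 / 2 := by rw [hr]; field_simp
  have hsum2 : Summable fun k : ℕ => (1 / 2 : ℝ) ^ k :=
    summable_geometric_of_lt_one (by norm_num) (by norm_num)
  have hbound : ∀ (y : ℕ → 𝒜) (D : ℝ), (∀ k, ‖y k‖ ≤ D * ρ ^ k) → 0 ≤ D → ∀ u : ℝ, |u| < r →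
      ∀ k, ‖u ^ k • y k‖ ≤ D * (1 / 2) ^ k := by
    intro y D hy hD u hu k
    rw [norm_smul, norm_pow, Real.norm_eq_abs]
    calc |u| ^ k * ‖y k‖ ≤ |u| ^ k * (D * ρ ^ k) := by gcongr; exact hy k
      _ = D * (|u| ^ k * ρ ^ k) := by ring
      _ ≤ D * (1 / 2) ^ k := by gcongr; exact hgeom u hu k
  have hHm : ∀ k, ‖H (m k)‖ ≤ (‖H‖ * ‖c‖) * ρ ^ k := fun k => by
    rw [mul_assoc]
    exact (H.le_opNorm _).trans (by gcongr; exact hmn k)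
  set T : ℝ → 𝒜 := fun u => ∑' k : ℕ, (2 / (k + 2) * u ^ (k + 2)) • H (m k) with hT
  have hTn : ∀ u : ℝ, |u| < r → Summable fun k : ℕ => ‖(2 / (k + 2) * u ^ (k + 2)) • H (m k)‖ := by
    intro u hu
    refine Summable.of_nonneg_of_le (fun _ => norm_nonneg _) (fun k => ?_)
      (hsum2.mul_left (‖H‖ * ‖c‖))
    have h1 := hbound _ _ hHm (by positivity) u hu k
    have e : (2 / (k + 2) * u ^ (k + 2)) • H (m k) = (2 / (k + 2) * u ^ 2) • (u ^ k • H (m k)) := by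
      rw [smul_smul]
      congr 1
      ring
    rw [e, norm_smul]
    have h2 : ‖(2 / (k + 2) * u ^ 2 : ℝ)‖ ≤ 1 := by
      rw [norm_mul, Real.norm_of_nonneg (by positivity), norm_pow, Real.norm_eq_abs]
      have h3 : (2 / (k + 2) : ℝ) ≤ 1 := by
        rw [div_le_one (by positivity)]
        have : (0 : ℝ) ≤ k := Nat.cast_nonneg k
        linarith
      have h4 : |u| ^ 2 ≤ 1 := pow_le_one₀ (abs_nonneg u) (hu.le.trans hr1)
      exact mul_le_one₀ h3 (by positivity) h4
    calc _ ≤ 1 * ‖u ^ k • H (m k)‖ := by gcongr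
      _ ≤ _ := by rwa [one_mul]
  have hGn : ∀ u : ℝ, |u| < r → Summable fun k : ℕ => ‖u ^ k • m k‖ := fun u hu =>
    Summable.of_nonneg_of_le (fun _ => norm_nonneg _)
      (hbound _ _ hmn (by positivity) u hu) (hsum2.mul_left _)
  have hG : ∀ u : ℝ, |u| < r → HasSum (fun k => u ^ k • m k) (cauchyTransform Φ x u b) := by
    intro u hu
    have hs : Summable fun k => u ^ k • word x (fun _ => c) k :=
      Summable.of_norm_bounded (hsum2.mul_left ‖c‖) (hbound _ _ hw (by positivity) u hu)
    have h1 := hs.hasSum.mapL Φ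
    rw [tsum_word_eq_inverse hbu (isUnit_of_le_imaginaryPart hε
      (le_imaginaryPart_sub_smul hx.selfAdjoint hbε u)) hs] at h1
    have h2 : (fun k => u ^ k • m k) = fun k => Φ (u ^ k • word x (fun _ => c) k) := by
      funext k
      rw [← Complex.coe_smul, ← Complex.coe_smul, map_smul]
    rw [h2]
    exact h1
  have hrecip : ∀ u : ℝ, |u| < r → Ring.inverse (cauchyTransform Φ x u b) = b - T u := by
    intro u hu
    have hGu := (cauchyTransform_spec hΦ hx.selfAdjoint hε hb hbε u).1
    have h1 : c * (T u * cauchyTransform Φ x u b) = cauchyTransform Φ x u b - c := by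
      rw [← (hG u hu).tsum_eq, hT,
        tsum_mul_tsum_eq_tsum_sum_antidiagonal_of_summable_norm (hTn u hu) (hGn u hu),
        ← (summable_norm_sum_mul_antidiagonal_of_summable_norm
          (hTn u hu) (hGn u hu)).of_norm.tsum_mul_left]
      have h2 := (hG u hu).summable.sum_add_tsum_nat_add 2
      rw [← h2]
      simp only [Finset.sum_range_succ, Finset.sum_range_zero, hm0, hm1, smul_zero, pow_zero,
        one_smul, zero_add, add_zero, add_sub_cancel_left]
      refine tsum_congr fun k => ?_
      have h3 : m (k + 2) = _ := hx.moment_add_two c hcΦ k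
      rw [h3, Finset.mul_sum, Finset.smul_sum]
      refine Finset.sum_congr rfl fun q hq => ?_
      rw [Finset.HasAntidiagonal.mem_antidiagonal] at hq
      have e : ((2 / (q.1 + 2) : ℂ)) = ((2 / (q.1 + 2) : ℝ) : ℂ) := by push_cast; rfl
      rw [e, Complex.coe_smul, smul_smul, smul_mul_smul_comm, mul_smul_comm, ← hq, ← mul_assoc]
      congr 1
      ring
    have h2 : (b - T u) * cauchyTransform Φ x u b = 1 := by
      have h3 : b * (c * (T u * cauchyTransform Φ x u b)) = T u * cauchyTransform Φ x u b := by
        rw [← mul_assoc, Ring.mul_inverse_cancel _ hbu, one_mul]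
      rw [sub_mul, ← h3, h1, mul_sub, Ring.mul_inverse_cancel _ hbu, sub_sub_cancel]
    rw [← one_mul (Ring.inverse _), ← h2, mul_assoc, Ring.mul_inverse_cancel _ hGu, mul_one]
  have hTd : ∀ u : ℝ, |u| < r → HasDerivAt T ((2 * u) • H (cauchyTransform Φ x u b)) u := by
    intro u hu
    have h1 := hasDerivAt_tsum_of_isPreconnected (𝕜 := ℝ)
      (g := fun (k : ℕ) (u : ℝ) => (2 / (k + 2) * u ^ (k + 2)) • H (m k))
      (g' := fun (k : ℕ) (u : ℝ) => (2 * u) • (u ^ k • H (m k)))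
      (u := fun k => 2 * ((‖H‖ * ‖c‖) * (1 / 2) ^ k)) (t := Metric.ball 0 r) (y₀ := 0) (y := u)
      ((hsum2.mul_left _).mul_left 2) Metric.isOpen_ball (convex_ball 0 r).isPreconnected
      (fun k y _ => ?_) (fun k y hy => ?_) (Metric.mem_ball_self hr0)
      (hTn 0 (by rwa [abs_zero])).of_norm (by simpa using hu)
    · refine h1.congr_deriv ?_
      have h2 := (hG u hu).mapL H
      have h3 := (h2.const_smul (2 * u)).tsum_eq
      rw [← h3]
      refine tsum_congr fun k => ?_
      congr 1
      rw [← Complex.coe_smul, ← Complex.coe_smul, map_smul]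
    · have h2 := ((hasDerivAt_pow (k + 2) y).const_mul (2 / (k + 2 : ℝ))).smul_const (H (m k))
      convert h2 using 1
      rw [smul_smul]
      congr 1
      have : (k + 2 : ℝ) ≠ 0 := by positivity
      push_cast
      field_simp
      ring
    · have hy' : |y| < r := by simpa using hy
      rw [norm_smul, norm_mul, Real.norm_eq_abs, Real.norm_eq_abs, abs_two]
      have h2 := hbound _ _ hHm (by positivity) y hy' k
      have h4 : |y| ≤ 1 := hy'.le.trans hr1
      calc 2 * |y| * ‖y ^ k • H (m k)‖ ≤ 2 * 1 * (‖H‖ * ‖c‖ * (1 / 2) ^ k) := by gcongr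
        _ = _ := by ring
  refine ⟨r, hr0, fun u hu => ?_⟩
  have h1 : HasDerivAt (fun u => b - T u) (-((2 * u) • H (cauchyTransform Φ x u b))) u :=
    (hTd u hu).const_sub b
  refine h1.congr_of_eventuallyEq ?_
  have : ∀ᶠ v in 𝓝 u, |v| < r := continuous_abs.continuousAt.eventually_lt continuousAt_const hu
  filter_upwards [this] with v hv using hrecip v hv

theorem analyticAt_cauchyTransform (hx : IsSelfAdjoint x) (hε : 0 < ε)
    (hbε : algebraMap ℝ 𝒜 ε ≤ ℑ b) (u : ℝ) :
    AnalyticAt ℝ (fun u => cauchyTransform Φ x u b) u := by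
  have h1 : AnalyticAt ℝ (fun u : ℝ => b - u • x) u :=
    analyticAt_const.sub (analyticAt_id.smul analyticAt_const)
  obtain ⟨v, hv⟩ := isUnit_of_le_imaginaryPart hε (le_imaginaryPart_sub_smul hx hbε u)
  have h2 : AnalyticAt ℝ (Ring.inverse : 𝒜 → 𝒜) (b - u • x) := hv ▸ analyticAt_inverse v
  exact ((Φ.restrictScalars ℝ).analyticAt _).comp (h2.comp (f := fun u : ℝ => b - u • x) h1)

theorem analyticAt_inverse_cauchyTransform (hΦ : IsCondExp (Φ : 𝒜 →ₗ[ℂ] 𝒜))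
    (hx : IsSelfAdjoint x) (hε : 0 < ε) (hb : Φ b = b) (hbε : algebraMap ℝ 𝒜 ε ≤ ℑ b) (u : ℝ) :
    AnalyticAt ℝ (fun u => Ring.inverse (cauchyTransform Φ x u b)) u := by
  obtain ⟨v, hv⟩ := (cauchyTransform_spec hΦ hx hε hb hbε u).1
  have h2 : AnalyticAt ℝ (Ring.inverse : 𝒜 → 𝒜) (cauchyTransform Φ x u b) :=
    hv ▸ analyticAt_inverse v
  exact h2.comp (f := fun u => cauchyTransform Φ x u b) (analyticAt_cauchyTransform hx hε hbε u)

/-- Both sides of the equation are real analytic in `u` on the whole line and agree near `0`, so the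
identity theorem applies. -/
theorem hasDerivAt_inverse_cauchyTransform (hΦ : IsCondExp (Φ : 𝒜 →ₗ[ℂ] 𝒜))
    (hx : IsArcsineOver Φ H x) (hε : 0 < ε) (hb : Φ b = b) (hbε : algebraMap ℝ 𝒜 ε ≤ ℑ b)
    (u : ℝ) : HasDerivAt (fun u => Ring.inverse (cauchyTransform Φ x u b))
      (-((2 * u) • H (cauchyTransform Φ x u b))) u := by
  have hF := analyticAt_inverse_cauchyTransform hΦ hx.selfAdjoint hε hb hbε
  obtain ⟨r, hr, h⟩ := hasDerivAt_inverse_cauchyTransform_of_small hΦ hx hε hb hbε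
  have h1 : AnalyticOnNhd ℝ (deriv fun u => Ring.inverse (cauchyTransform Φ x u b)) Set.univ :=
    fun u _ => (hF u).deriv
  have h2 : AnalyticOnNhd ℝ (fun u => -((2 * u) • H (cauchyTransform Φ x u b))) Set.univ :=
    fun u _ => ((analyticAt_const.mul analyticAt_id).smul
      (((H.restrictScalars ℝ).analyticAt _).comp
        (analyticAt_cauchyTransform hx.selfAdjoint hε hbε u))).neg
  have h3 := h1.eq_of_eventuallyEq h2 (z₀ := 0) (by
    have : ∀ᶠ v in 𝓝 (0 : ℝ), |v| < r :=
      continuous_abs.continuousAt.eventually_lt continuousAt_const (by simpa using hr)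
    filter_upwards [this] with v hv using (h v hv).deriv)
  rw [← congrFun h3 u]
  exact (hF u).differentiableAt.hasDerivAt

theorem flow_spec (hΦ : IsCondExp (Φ : 𝒜 →ₗ[ℂ] 𝒜)) (hx : IsSelfAdjoint x)
    (hε : 0 < ε) (hb : Φ b = b) (hbε : algebraMap ℝ 𝒜 ε ≤ ℑ b) (s : ℝ) :
    Φ (flow Φ x s b) = flow Φ x s b ∧ algebraMap ℝ 𝒜 ε ≤ ℑ (flow Φ x s b) :=
  have h := cauchyTransform_spec hΦ hx hε hb hbε √s
  ⟨h.2.2, hbε.trans h.2.1⟩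

theorem inverse_flow (hΦ : IsCondExp (Φ : 𝒜 →ₗ[ℂ] 𝒜)) (hx : IsSelfAdjoint x)
    (hε : 0 < ε) (hb : Φ b = b) (hbε : algebraMap ℝ 𝒜 ε ≤ ℑ b) (s : ℝ) :
    Ring.inverse (flow Φ x s b) = cauchyTransform Φ x √s b :=
  Ring.inverse_inverse (cauchyTransform_spec hΦ hx hε hb hbε √s).1

theorem flow_zero (hΦ : IsCondExp (Φ : 𝒜 →ₗ[ℂ] 𝒜)) (hε : 0 < ε) (hb : Φ b = b)
    (hbε : algebraMap ℝ 𝒜 ε ≤ ℑ b) : flow Φ x 0 b = b := by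
  have hu := isUnit_of_le_imaginaryPart hε hbε
  have h : Φ (Ring.inverse b) = Ring.inverse b := hΦ.map_inverse hb hu
  rw [flow, cauchyTransform, Real.sqrt_zero, zero_smul, sub_zero, h, Ring.inverse_inverse hu]

theorem continuous_flow (hΦ : IsCondExp (Φ : 𝒜 →ₗ[ℂ] 𝒜)) (hx : IsSelfAdjoint x)
    (hε : 0 < ε) (hb : Φ b = b) (hbε : algebraMap ℝ 𝒜 ε ≤ ℑ b) :
    Continuous fun s => flow Φ x s b :=
  (continuous_iff_continuousAt.2 fun u =>
    (analyticAt_inverse_cauchyTransform hΦ hx hε hb hbε u).continuousAt).comp Real.continuous_sqrt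

/-- The substitution `u = √s` absorbs the factor `2u` and makes the equation autonomous. As `√` is
not differentiable at `0`, the right derivative there is obtained as a limit of derivatives. -/
theorem hasDerivWithinAt_flow (hΦ : IsCondExp (Φ : 𝒜 →ₗ[ℂ] 𝒜))
    (hx : IsArcsineOver Φ H x) (hε : 0 < ε) (hb : Φ b = b) (hbε : algebraMap ℝ 𝒜 ε ≤ ℑ b)
    {s : ℝ} (hs : 0 ≤ s) : HasDerivWithinAt (fun s => flow Φ x s b)
      (-H (Ring.inverse (flow Φ x s b))) (Set.Ici s) s := by
  have hpos : ∀ s : ℝ, 0 < s → HasDerivAt (fun s => flow Φ x s b)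
      (-H (cauchyTransform Φ x √s b)) s := by
    intro s hs
    have h1 := (hasDerivAt_inverse_cauchyTransform hΦ hx hε hb hbε √s).scomp s
      (Real.hasDerivAt_sqrt hs.ne')
    refine h1.congr_deriv ?_
    rw [smul_neg, smul_smul]
    have : √s ≠ 0 := (Real.sqrt_pos.2 hs).ne'
    rw [show 1 / (2 * √s) * (2 * √s) = 1 by field_simp, one_smul]
  rw [inverse_flow hΦ hx.selfAdjoint hε hb hbε]
  rcases hs.eq_or_lt with rfl | hs
  · refine hasDerivWithinAt_Ici_of_tendsto_deriv (s := Set.Ioi 0)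
      (fun s hs => (hpos s hs).differentiableAt.differentiableWithinAt)
      (continuous_flow hΦ hx.selfAdjoint hε hb hbε).continuousWithinAt self_mem_nhdsWithin ?_
    have hc : Continuous fun s => -H (cauchyTransform Φ x √s b) :=
      (H.continuous.comp ((continuous_iff_continuousAt.2 fun u =>
        (analyticAt_cauchyTransform (Φ := Φ) hx.selfAdjoint hε hbε u).continuousAt).comp
          Real.continuous_sqrt)).neg
    refine ((hc.tendsto 0).mono_left nhdsWithin_le_nhds).congr' ?_
    filter_upwards [self_mem_nhdsWithin] with s hs using (hpos s hs).deriv.symm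
  · exact (hpos s hs).hasDerivWithinAt

/-- As functions of `s`, both sides solve `y' = -H(y⁻¹)` with the same initial value and stay in `Im
≥ ε`, where the vector field is Lipschitz. -/
theorem flow_add (hΦ : IsCondExp (Φ : 𝒜 →ₗ[ℂ] 𝒜))
    (hx : IsArcsineOver Φ H x) (hε : 0 < ε) (hb : Φ b = b) (hbε : algebraMap ℝ 𝒜 ε ≤ ℑ b)
    {s t : ℝ} (hs : 0 ≤ s) (ht : 0 ≤ t) :
    flow Φ x (s + t) b = flow Φ x s (flow Φ x t b) := by
  have hsa := hx.selfAdjoint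
  have ht' := flow_spec hΦ hsa hε hb hbε t
  have hlip : ∀ r ∈ Set.Ico 0 s, LipschitzOnWith (‖H‖₊ * (1 / ε ^ 2).toNNReal)
      (fun y => -H (Ring.inverse y)) {y : 𝒜 | algebraMap ℝ 𝒜 ε ≤ ℑ y} := by
    refine fun _ _ => LipschitzOnWith.of_dist_le_mul fun y hy z hz => ?_
    rw [dist_neg_neg, dist_eq_norm, dist_eq_norm, ← map_sub]
    refine (H.le_opNorm _).trans ?_
    rw [NNReal.coe_mul, coe_nnnorm, Real.coe_toNNReal _ (by positivity), mul_assoc]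
    gcongr
    exact norm_inverse_sub_inverse_le hε hy hz
  refine ODE_solution_unique_of_mem_Icc_right (v := fun _ y => -H (Ring.inverse y))
    (s := fun _ => {y : 𝒜 | algebraMap ℝ 𝒜 ε ≤ ℑ y}) (f := fun r => flow Φ x (r + t) b)
    (g := fun r => flow Φ x r (flow Φ x t b)) (a := 0) (b := s) hlip
    ((continuous_flow hΦ hsa hε hb hbε).comp (continuous_add_const t)).continuousOn
    (fun r hr => ?_) (fun r _ => (flow_spec hΦ hsa hε hb hbε (r + t)).2)
    (continuous_flow hΦ hsa hε ht'.1 ht'.2).continuousOn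
    (fun r hr => hasDerivWithinAt_flow hΦ hx hε ht'.1 ht'.2 hr.1)
    (fun r _ => (flow_spec hΦ hsa hε ht'.1 ht'.2 r).2) ?_ (Set.right_mem_Icc.2 hs)
  · have h1 := hasDerivWithinAt_flow hΦ hx hε hb hbε (add_nonneg hr.1 ht)
    have h2 : HasDerivWithinAt (fun r : ℝ => r + t) 1 (Set.Ici r) r :=
      ((hasDerivAt_id r).add_const t).hasDerivWithinAt
    have h3 := HasDerivWithinAt.scomp r h1 h2 fun y (hy : r ≤ y) => add_le_add_left hy t
    rwa [one_smul] at h3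
  · simp only [zero_add]
    exact (flow_zero hΦ hε ht'.1 ht'.2).symm

theorem norm_flow_sub_le (hΦ : IsCondExp (Φ : 𝒜 →ₗ[ℂ] 𝒜))
    (hx : IsArcsineOver Φ H x) (hε : 0 < ε) (hb : Φ b = b) (hbε : algebraMap ℝ 𝒜 ε ≤ ℑ b)
    {h : ℝ} (hh : 0 ≤ h) : ‖flow Φ x h b - b‖ ≤ ‖H‖ / ε * h := by
  have h1 := norm_image_sub_le_of_norm_deriv_right_le_segment (C := ‖H‖ / ε)
    (continuous_flow hΦ hx.selfAdjoint hε hb hbε).continuousOn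
    (fun s (hs : s ∈ Set.Ico 0 h) => hasDerivWithinAt_flow hΦ hx hε hb hbε hs.1) (fun s _ => by
      rw [norm_neg, div_eq_mul_one_div]
      refine (H.le_opNorm _).trans ?_
      gcongr
      exact norm_inverse_le_of_le_imaginaryPart hε (flow_spec hΦ hx.selfAdjoint hε hb hbε s).2) h
    (Set.right_mem_Icc.2 hh)
  rwa [flow_zero hΦ hε hb hbε, sub_zero] at h1

/-- Short time comparison of two flows. -/
theorem norm_flow_sub_flow_le {H₀ H₁ : 𝒜 →L[ℂ] 𝒜} {x₀ x₁ : 𝒜} (hΦ : IsCondExp (Φ : 𝒜 →ₗ[ℂ] 𝒜))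
    (hx₀ : IsArcsineOver Φ H₀ x₀) (hx₁ : IsArcsineOver Φ H₁ x₁) {K : ℝ}
    (hK : ∀ a, ‖H₁ a - H₀ a‖ ≤ K * ‖a‖) (hK0 : 0 ≤ K) (hε : 0 < ε) (hb : Φ b = b)
    (hbε : algebraMap ℝ 𝒜 ε ≤ ℑ b) {h : ℝ} (hh : 0 ≤ h) :
    ‖flow Φ x₁ h b - flow Φ x₀ h b‖ ≤
      (K / ε + ‖H₀‖ * (1 / ε ^ 2) * ((‖H₁‖ + ‖H₀‖) / ε * h)) * h := by
  have s₀ := flow_spec hΦ hx₀.selfAdjoint hε hb hbε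
  have s₁ := flow_spec hΦ hx₁.selfAdjoint hε hb hbε
  have h1 := norm_image_sub_le_of_norm_deriv_right_le_segment
    (C := K / ε + ‖H₀‖ * (1 / ε ^ 2) * ((‖H₁‖ + ‖H₀‖) / ε * h))
    ((continuous_flow hΦ hx₁.selfAdjoint hε hb hbε).sub
      (continuous_flow hΦ hx₀.selfAdjoint hε hb hbε)).continuousOn
    (fun s (hs : s ∈ Set.Ico 0 h) => (hasDerivWithinAt_flow hΦ hx₁ hε hb hbε hs.1).sub
      (hasDerivWithinAt_flow hΦ hx₀ hε hb hbε hs.1)) (fun s hs => by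
      have e : -H₁ (Ring.inverse (flow Φ x₁ s b)) - -H₀ (Ring.inverse (flow Φ x₀ s b)) =
          -((H₁ (Ring.inverse (flow Φ x₁ s b)) - H₀ (Ring.inverse (flow Φ x₁ s b))) +
            H₀ (Ring.inverse (flow Φ x₁ s b) - Ring.inverse (flow Φ x₀ s b))) := by
        rw [map_sub]
        abel
      rw [e, norm_neg]
      refine (norm_add_le _ _).trans (add_le_add ?_ ?_)
      · refine (hK _).trans ?_
        rw [div_eq_mul_one_div]
        gcongr
        exact norm_inverse_le_of_le_imaginaryPart hε (s₁ s).2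
      · refine (H₀.le_opNorm _).trans ?_
        rw [mul_assoc]
        gcongr
        refine (norm_inverse_sub_inverse_le hε (s₁ s).2 (s₀ s).2).trans ?_
        gcongr
        have e2 : flow Φ x₁ s b - flow Φ x₀ s b =
          (flow Φ x₁ s b - b) - (flow Φ x₀ s b - b) := by abel
        rw [e2]
        refine (norm_sub_le _ _).trans ?_
        have a1 := norm_flow_sub_le hΦ hx₁ hε hb hbε hs.1
        have a0 := norm_flow_sub_le hΦ hx₀ hε hb hbε hs.1
        calc _ ≤ ‖H₁‖ / ε * s + ‖H₀‖ / ε * s := add_le_add a1 a0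
          _ = (‖H₁‖ + ‖H₀‖) / ε * s := by ring
          _ ≤ _ := by gcongr; exact hs.2.le) h (Set.right_mem_Icc.2 hh)
  simp only [Pi.sub_apply, sub_zero] at h1
  rwa [flow_zero hΦ hε hb hbε, flow_zero hΦ hε hb hbε, sub_self, sub_zero] at h1

end Flow

/-! ### Integrals along horizontal lines -/

section HorizontalLine

open Filter Topology

theorem normSq_horizontal (t ε : ℝ) : ‖(t + ε * Complex.I : ℂ)‖ ^ 2 = t ^ 2 + ε ^ 2 := by
  rw [← Complex.normSq_eq_norm_sq, Complex.normSq_add_mul_I]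

theorem inv_sq_add_sq_eq {ε : ℝ} (hε : 0 < ε) (t : ℝ) :
    1 / (t ^ 2 + ε ^ 2) = 1 / ε ^ 2 * (1 + (t / ε) ^ 2)⁻¹ := by
  field_simp
  ring

theorem integrable_inv_sq_add_sq {ε : ℝ} (hε : 0 < ε) :
    Integrable fun t : ℝ => 1 / (t ^ 2 + ε ^ 2) := by
  simp only [inv_sq_add_sq_eq hε]
  exact (integrable_inv_one_add_sq.comp_div hε.ne').const_mul _

theorem integral_inv_sq_add_sq {ε : ℝ} (hε : 0 < ε) :
    ∫ t : ℝ, 1 / (t ^ 2 + ε ^ 2) = Real.pi / ε := by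
  simp only [inv_sq_add_sq_eq hε]
  rw [integral_const_mul, Measure.integral_comp_div (fun t : ℝ => (1 + t ^ 2)⁻¹) ε,
    integral_univ_inv_one_add_sq, abs_of_pos hε, smul_eq_mul]
  field_simp

theorem im_inv_horizontal (t ε : ℝ) :
    ((t + ε * Complex.I : ℂ)⁻¹).im = -(ε * (1 / (t ^ 2 + ε ^ 2))) := by
  rw [Complex.inv_im, Complex.normSq_add_mul_I]
  simp
  ring

variable {d : ℂ → ℂ} {ε C : ℝ}

theorem continuous_horizontal (hd : DifferentiableOn ℂ d {z | 0 < z.im}) (hε : 0 < ε) :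
    Continuous fun t : ℝ => d (t + ε * Complex.I) := by
  refine hd.continuousOn.comp_continuous (by fun_prop) fun t => ?_
  simpa using hε

theorem integrable_horizontal (hd : DifferentiableOn ℂ d {z | 0 < z.im}) (hε : 0 < ε)
    (hC : ∀ z : ℂ, ε ≤ z.im → ‖d z‖ ≤ C / ‖z‖ ^ 2) :
    Integrable fun t : ℝ => d (t + ε * Complex.I) := by
  refine ((integrable_inv_sq_add_sq hε).const_mul C).mono'
    (continuous_horizontal hd hε).aestronglyMeasurable (ae_of_all _ fun t => ?_)
  have := hC (t + ε * Complex.I) (by simp)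
  rwa [normSq_horizontal, div_eq_mul_one_div] at this

/-- The integral of a holomorphic function of quadratic decay along a horizontal line vanishes. -/
theorem integral_horizontal_eq_zero (hd : DifferentiableOn ℂ d {z | 0 < z.im}) (hε : 0 < ε)
    (hC : ∀ z : ℂ, ε ≤ z.im → ‖d z‖ ≤ C / ‖z‖ ^ 2) :
    ∫ t : ℝ, d (t + ε * Complex.I) = 0 := by
  have hC0 : 0 ≤ C := by
    have h1 := (norm_nonneg _).trans (hC (ε * Complex.I) (by simp))
    have h2 : 0 < ‖(ε * Complex.I : ℂ)‖ ^ 2 := by simp; positivity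
    by_contra hneg
    exact absurd h1 (not_le.2 (div_neg_of_neg_of_pos (not_le.1 hneg) h2))
  have hlim := intervalIntegral_tendsto_integral (integrable_horizontal hd hε hC)
    (tendsto_neg_atTop_atBot (G := ℝ)) tendsto_id
  refine tendsto_nhds_unique hlim ?_
  rw [tendsto_zero_iff_norm_tendsto_zero]
  -- On the rectangle `[-T, T] × [ε, T]`, the top side contributes at most `2C / T` and each
  -- vertical side at most `C / T`.
  have hmaj : Tendsto (fun T : ℝ => 4 * C / T) atTop (𝓝 0) :=
    tendsto_const_nhds.div_atTop tendsto_id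
  refine tendsto_of_tendsto_of_tendsto_of_le_of_le' tendsto_const_nhds hmaj
    (Eventually.of_forall fun _ => norm_nonneg _) ?_
  filter_upwards [eventually_gt_atTop ε] with T hT
  have hT0 : 0 < T := hε.trans hT
  have hrect := Complex.integral_boundary_rect_eq_zero_of_differentiableOn d
    (-T + ε * Complex.I) (T + T * Complex.I) (hd.mono fun z hz => by
      have h1 : z.im ∈ Set.uIcc ε T := by simpa using (Complex.mem_reProdIm.1 hz).2
      rw [Set.uIcc_of_le hT.le] at h1
      exact hε.trans_le h1.1)
  simp only [Complex.add_re, Complex.neg_re, Complex.ofReal_re, Complex.mul_re, Complex.I_re,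
    mul_zero, Complex.ofReal_im, Complex.I_im, mul_one, sub_self, add_zero, Complex.add_im,
    Complex.neg_im, neg_zero, Complex.mul_im, zero_add] at hrect
  have hre : ∀ a b : ℝ, |a| ≤ ‖(a + b * Complex.I : ℂ)‖ := fun a b => by
    simpa using Complex.abs_re_le_norm (a + b * Complex.I : ℂ)
  have him : ∀ a b : ℝ, |b| ≤ ‖(a + b * Complex.I : ℂ)‖ := fun a b => by
    simpa using Complex.abs_im_le_norm (a + b * Complex.I : ℂ)
  have hbd : ∀ a b : ℝ, ε ≤ b → T ≤ ‖(a + b * Complex.I : ℂ)‖ →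
      ‖d (a + b * Complex.I)‖ ≤ C / T ^ 2 := fun a b hb hT' =>
    (hC _ (by simpa using hb)).trans (by gcongr)
  have htop : ‖∫ x : ℝ in -T..T, d (x + T * Complex.I)‖ ≤ C / T ^ 2 * |T - -T| :=
    intervalIntegral.norm_integral_le_of_norm_le_const fun x _ =>
      hbd x T hT.le ((le_abs_self T).trans (him x T))
  have hright : ‖∫ y : ℝ in ε..T, d (T + y * Complex.I)‖ ≤ C / T ^ 2 * |T - ε| :=
    intervalIntegral.norm_integral_le_of_norm_le_const fun y hy => by
      rw [Set.uIoc_of_le hT.le] at hy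
      exact hbd T y hy.1.le ((le_abs_self T).trans (hre T y))
  have hleft : ‖∫ y : ℝ in ε..T, d ((-T : ℝ) + y * Complex.I)‖ ≤ C / T ^ 2 * |T - ε| :=
    intervalIntegral.norm_integral_le_of_norm_le_const fun y hy => by
      rw [Set.uIoc_of_le hT.le] at hy
      exact hbd (-T) y hy.1.le (((le_abs_self T).trans_eq (abs_neg T).symm).trans (hre (-T) y))
  have e : ∫ x : ℝ in -T..T, d (x + ε * Complex.I) =
      (∫ x : ℝ in -T..T, d (x + T * Complex.I)) -
        Complex.I • (∫ y : ℝ in ε..T, d (T + y * Complex.I)) +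
        Complex.I • ∫ y : ℝ in ε..T, d ((-T : ℝ) + y * Complex.I) := by
    linear_combination hrect
  simp only [id]
  rw [e]
  refine (norm_add_le _ _).trans ?_
  have h1 := norm_sub_le (∫ x : ℝ in -T..T, d (x + T * Complex.I))
    (Complex.I • ∫ y : ℝ in ε..T, d (T + y * Complex.I))
  rw [norm_smul, Complex.norm_I, one_mul] at h1 ⊢
  rw [abs_of_pos (by linarith)] at htop
  rw [abs_of_pos (by linarith)] at hright hleft
  have h2 : C / T ^ 2 * (T - ε) ≤ C / T ^ 2 * T := by gcongr; linarith
  have h3 : C / T ^ 2 * (T - -T) + C / T ^ 2 * T + C / T ^ 2 * T = 4 * C / T := by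
    field_simp
    ring
  linarith

/-- A holomorphic function on the upper half plane which is asymptotic to `1 / z` up to a quadratic
error has total mass `π` along each horizontal line. -/
theorem integral_neg_im_horizontal {g : ℂ → ℂ} (hg : DifferentiableOn ℂ g {z | 0 < z.im})
    (hε : 0 < ε) (hC : ∀ z : ℂ, ε ≤ z.im → ‖g z - z⁻¹‖ ≤ C / ‖z‖ ^ 2) :
    Integrable (fun t : ℝ => -(g (t + ε * Complex.I)).im) ∧
      ∫ t : ℝ, -(g (t + ε * Complex.I)).im = Real.pi := by
  have hd : DifferentiableOn ℂ (fun z => g z - z⁻¹) {z | 0 < z.im} :=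
    hg.sub fun z (hz : 0 < z.im) => (differentiableAt_inv (by
      rintro rfl
      simp at hz)).differentiableWithinAt
  have hi := integrable_horizontal hd hε hC
  have h0 := integral_horizontal_eq_zero hd hε hC
  have e : ∀ t : ℝ, -(g (t + ε * Complex.I)).im =
      -(g (t + ε * Complex.I) - (t + ε * Complex.I : ℂ)⁻¹).im + ε * (1 / (t ^ 2 + ε ^ 2)) := by
    intro t
    rw [Complex.sub_im, im_inv_horizontal]
    ring
  have hP := (integrable_inv_sq_add_sq hε).const_mul ε
  have him : Integrable fun t : ℝ => -(g (t + ε * Complex.I) - (t + ε * Complex.I : ℂ)⁻¹).im :=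
    hi.im.neg
  simp only [e]
  refine ⟨him.add hP, ?_⟩
  rw [integral_add him hP, integral_neg, integral_const_mul, integral_inv_sq_add_sq hε]
  have : ∫ t : ℝ, (g (t + ε * Complex.I) - (t + ε * Complex.I : ℂ)⁻¹).im = 0 := by
    have := integral_im hi
    rw [h0] at this
    simpa using this
  rw [this]
  field_simp
  simp

end HorizontalLine

/-! ### Interpolation between two Cauchy transforms -/

section Interpolation

open Filter Topology

variable {𝒜 : Type*} [CStarAlgebra 𝒜]

/-- The Cauchy transform of `√s x₁` composed with the reciprocal Cauchy transform of
`√(1 - s) x₀`. -/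
def interpolation (Φ : 𝒜 →L[ℂ] 𝒜) (x₀ x₁ : 𝒜) (s : ℝ) (b : 𝒜) : 𝒜 :=
  cauchyTransform Φ x₁ √s (flow Φ x₀ (1 - s) b)

variable [PartialOrder 𝒜] [StarOrderedRing 𝒜]

variable {Φ H H₀ H₁ : 𝒜 →L[ℂ] 𝒜} {x x₀ x₁ b : 𝒜} {ε K : ℝ}

/-- The semigroup law `flow_add` after taking inverses. -/
theorem cauchyTransform_flow (hΦ : IsCondExp (Φ : 𝒜 →ₗ[ℂ] 𝒜)) (hx : IsArcsineOver Φ H x)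
    (hε : 0 < ε) (hb : Φ b = b) (hbε : algebraMap ℝ 𝒜 ε ≤ ℑ b) {s h : ℝ} (hs : 0 ≤ s)
    (hh : 0 ≤ h) : cauchyTransform Φ x √s (flow Φ x h b) = cauchyTransform Φ x √(s + h) b := by
  have hf := flow_spec hΦ hx.selfAdjoint hε hb hbε h
  rw [← inverse_flow hΦ hx.selfAdjoint hε hf.1 hf.2, ← flow_add hΦ hx hε hb hbε hs hh,
    inverse_flow hΦ hx.selfAdjoint hε hb hbε]

theorem interpolation_one (hΦ : IsCondExp (Φ : 𝒜 →ₗ[ℂ] 𝒜)) (hε : 0 < ε) (hb : Φ b = b)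
    (hbε : algebraMap ℝ 𝒜 ε ≤ ℑ b) :
    interpolation Φ x₀ x₁ 1 b = cauchyTransform Φ x₁ 1 b := by
  rw [interpolation, sub_self, flow_zero hΦ hε hb hbε, Real.sqrt_one]

theorem interpolation_zero (hΦ : IsCondExp (Φ : 𝒜 →ₗ[ℂ] 𝒜)) (hx₀ : IsSelfAdjoint x₀)
    (hε : 0 < ε) (hb : Φ b = b) (hbε : algebraMap ℝ 𝒜 ε ≤ ℑ b) :
    interpolation Φ x₀ x₁ 0 b = cauchyTransform Φ x₀ 1 b := by
  have hf := flow_spec hΦ hx₀ hε hb hbε (1 - 0)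
  have h : Φ (Ring.inverse (flow Φ x₀ (1 - 0) b)) = Ring.inverse (flow Φ x₀ (1 - 0) b) :=
    hΦ.map_inverse hf.1 (isUnit_of_le_imaginaryPart hε hf.2)
  rw [interpolation, cauchyTransform, Real.sqrt_zero, zero_smul, sub_zero, h,
    inverse_flow hΦ hx₀ hε hb hbε, sub_zero, Real.sqrt_one]

/-- The increment of the interpolation in terms of resolvents. -/
theorem exists_interpolation_increment (hΦ : IsCondExp (Φ : 𝒜 →ₗ[ℂ] 𝒜))
    (hx₀ : IsArcsineOver Φ H₀ x₀) (hx₁ : IsArcsineOver Φ H₁ x₁)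
    (hK : ∀ a, ‖H₁ a - H₀ a‖ ≤ K * ‖a‖) (hK0 : 0 ≤ K) (hε : 0 < ε) (hb : Φ b = b)
    (hbε : algebraMap ℝ 𝒜 ε ≤ ℑ b) {s h : ℝ} (hs : 0 ≤ s) (hh : 0 ≤ h) (hsh : s + h ≤ 1) :
    ∃ y z : 𝒜, algebraMap ℝ 𝒜 ε ≤ ℑ y ∧ algebraMap ℝ 𝒜 ε ≤ ℑ z ∧
      ‖z - y‖ ≤ (K / ε + ‖H₀‖ * (1 / ε ^ 2) * ((‖H₁‖ + ‖H₀‖) / ε * h)) * h ∧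
      interpolation Φ x₀ x₁ (s + h) b = Φ (Ring.inverse y) ∧
      interpolation Φ x₀ x₁ s b = Φ (Ring.inverse z) := by
  have hc := flow_spec hΦ hx₀.selfAdjoint hε hb hbε (1 - (s + h))
  -- The common starting point. From `c`, the value at `s + h` flows along `x₁` for time `h` and the
  -- value at `s` along `x₀`; both then apply the Cauchy transform of `√s x₁`.
  set c := flow Φ x₀ (1 - (s + h)) b with hcdef
  have h₁ := flow_spec hΦ hx₁.selfAdjoint hε hc.1 hc.2 h
  have h₀ := flow_spec hΦ hx₀.selfAdjoint hε hc.1 hc.2 h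
  refine ⟨flow Φ x₁ h c - √s • x₁, flow Φ x₀ h c - √s • x₁,
    le_imaginaryPart_sub_smul hx₁.selfAdjoint h₁.2 _,
    le_imaginaryPart_sub_smul hx₁.selfAdjoint h₀.2 _, ?_, ?_, ?_⟩
  · rw [sub_sub_sub_cancel_right, norm_sub_rev]
    exact norm_flow_sub_flow_le hΦ hx₀ hx₁ hK hK0 hε hc.1 hc.2 hh
  · exact (cauchyTransform_flow hΦ hx₁ hε hc.1 hc.2 hs hh).symm
  · rw [interpolation, hcdef, ← flow_add hΦ hx₀ hε hb hbε hh (by linarith),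
      show h + (1 - (s + h)) = 1 - s by ring]
    rfl

theorem le_of_forall_nat_add_div {a b L : ℝ} (h : ∀ N : ℕ, 0 < N → a ≤ b + L / N) : a ≤ b := by
  have h1 : Tendsto (fun N : ℕ => b + L / N) atTop (𝓝 (b + 0)) :=
    tendsto_const_nhds.add (tendsto_const_div_atTop_nhds_zero_nat L)
  rw [add_zero] at h1
  refine ge_of_tendsto h1 ?_
  filter_upwards [eventually_gt_atTop 0] with N hN using h N hN

theorem interpolation_sub_eq_sum (hΦ : IsCondExp (Φ : 𝒜 →ₗ[ℂ] 𝒜)) (hx₀ : IsSelfAdjoint x₀)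
    (hε : 0 < ε) (hb : Φ b = b) (hbε : algebraMap ℝ 𝒜 ε ≤ ℑ b) {N : ℕ} (hN : 0 < N) :
    cauchyTransform Φ x₁ 1 b - cauchyTransform Φ x₀ 1 b =
      ∑ i ∈ Finset.range N, (interpolation Φ x₀ x₁ (i / N + 1 / N) b -
        interpolation Φ x₀ x₁ (i / N) b) := by
  have hN' : (N : ℝ) ≠ 0 := by positivity
  have h := Finset.sum_range_sub (fun i : ℕ => interpolation Φ x₀ x₁ (i / N) b) N
  rw [div_self hN', interpolation_one hΦ hε hb hbε, Nat.cast_zero, zero_div,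
    interpolation_zero hΦ hx₀ hε hb hbε] at h
  rw [← h]
  refine Finset.sum_congr rfl fun i _ => ?_
  rw [← add_div]
  push_cast
  rfl

theorem div_add_inv_le_one {i N : ℕ} (h : i < N) : (i / N + 1 / N : ℝ) ≤ 1 := by
  have hN : (0 : ℝ) < N := by exact_mod_cast (Nat.zero_le i).trans_lt h
  rw [← add_div, div_le_one hN]
  exact_mod_cast h

/-- Each of the `N` increments is at most `ε⁻² (K / ε + O(1/N)) / N`, by the resolvent identity and
contractivity of `Φ`. -/
theorem norm_cauchyTransform_sub_le (hΦ : IsCondExp (Φ : 𝒜 →ₗ[ℂ] 𝒜))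
    (hx₀ : IsArcsineOver Φ H₀ x₀) (hx₁ : IsArcsineOver Φ H₁ x₁)
    (hK : ∀ a, ‖H₁ a - H₀ a‖ ≤ K * ‖a‖) (hK0 : 0 ≤ K) (hε : 0 < ε) (hb : Φ b = b)
    (hbε : algebraMap ℝ 𝒜 ε ≤ ℑ b) :
    ‖cauchyTransform Φ x₁ 1 b - cauchyTransform Φ x₀ 1 b‖ ≤ K * (1 / ε) ^ 3 := by
  refine le_of_forall_nat_add_div
    (L := (1 / ε) ^ 2 * (‖H₀‖ * (1 / ε ^ 2) * ((‖H₁‖ + ‖H₀‖) / ε))) fun N hN => ?_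
  have hN' : (0 : ℝ) < N := by exact_mod_cast hN
  rw [interpolation_sub_eq_sum hΦ hx₀.selfAdjoint hε hb hbε hN]
  have hstep : ∀ i ∈ Finset.range N, ‖interpolation Φ x₀ x₁ (i / N + 1 / N) b -
      interpolation Φ x₀ x₁ (i / N) b‖ ≤ (1 / ε) ^ 2 *
        ((K / ε + ‖H₀‖ * (1 / ε ^ 2) * ((‖H₁‖ + ‖H₀‖) / ε * (1 / N))) * (1 / N)) := by
    intro i hi
    obtain ⟨y, z, hy, hz, hyz, e1, e0⟩ := exists_interpolation_increment hΦ hx₀ hx₁ hK hK0 hε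
      hb hbε (s := i / N) (h := 1 / N) (by positivity) (by positivity)
      (div_add_inv_le_one (Finset.mem_range.1 hi))
    rw [e1, e0, ← map_sub]
    refine (hΦ.norm_map_le _).trans ?_
    refine (norm_inverse_sub_inverse_le hε hy hz).trans ?_
    rw [one_div_pow, norm_sub_rev]
    gcongr
  refine (norm_sum_le _ _).trans ((Finset.sum_le_card_nsmul _ _ _ hstep).trans_eq ?_)
  rw [Finset.card_range, nsmul_eq_mul]
  field_simp

end Interpolation

/-! ### States -/

section State

variable {𝒜 : Type*} [CStarAlgebra 𝒜] [PartialOrder 𝒜] [StarOrderedRing 𝒜]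
  {φ : 𝒜 →ₚ[ℂ] ℂ}

theorem map_star_eq_conj (φ : 𝒜 →ₚ[ℂ] ℂ) (a : 𝒜) : φ (star a) = (starRingEnd ℂ) (φ a) :=
  StarHomClass.map_star φ a

theorem re_map_imaginaryPart (φ : 𝒜 →ₚ[ℂ] ℂ) (a : 𝒜) : (φ (ℑ a : 𝒜)).re = (φ a).im := by
  rw [coe_imaginaryPart_eq, map_smul, map_sub, map_star_eq_conj]
  simp
  ring

theorem re_map_mono (φ : 𝒜 →ₚ[ℂ] ℂ) {a b : 𝒜} (h : a ≤ b) : (φ a).re ≤ (φ b).re :=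
  (Complex.le_def.1 (OrderHomClass.mono φ h)).1

/-- Cauchy–Schwarz for the GNS form, on which left multiplication by `h` is bounded by `‖h‖`,
followed by the arithmetic–geometric mean inequality. -/
theorem norm_map_mul_mul_le (φ : 𝒜 →ₚ[ℂ] ℂ) (a h b : 𝒜) :
    ‖φ (a * h * b)‖ ≤ ‖h‖ * (((φ (a * star a)).re + (φ (star b * b)).re) / 2) := by
  set v := φ.toPreGNS (star a)
  set w := φ.toPreGNS b
  have h1 : φ (a * h * b) = inner ℂ v (φ.leftMulMapPreGNS h w) := by
    rw [PositiveLinearMap.preGNS_inner_def]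
    simp [v, w, mul_assoc]
  have h2 : ‖φ.leftMulMapPreGNS h w‖ ≤ ‖h‖ * ‖w‖ :=
    ((φ.leftMulMapPreGNS h).le_opNorm w).trans (by
      gcongr
      exact LinearMap.mkContinuous_norm_le _ (norm_nonneg h) _)
  have hv : (φ (a * star a)).re = ‖v‖ ^ 2 := by
    have := congrArg Complex.re (PositiveLinearMap.preGNS_norm_sq φ v)
    simpa [v, ← Complex.ofReal_pow] using this.symm
  have hw : (φ (star b * b)).re = ‖w‖ ^ 2 := by
    have := congrArg Complex.re (PositiveLinearMap.preGNS_norm_sq φ w)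
    simpa [w, ← Complex.ofReal_pow] using this.symm
  rw [h1, hv, hw]
  calc ‖inner ℂ v (φ.leftMulMapPreGNS h w)‖ ≤ ‖v‖ * (‖h‖ * ‖w‖) :=
        (norm_inner_le_norm _ _).trans (by gcongr)
    _ = ‖h‖ * (‖v‖ * ‖w‖) := by ring
    _ ≤ _ := by
      gcongr
      nlinarith [sq_nonneg (‖v‖ - ‖w‖)]

variable {y z : 𝒜} {ε : ℝ}

/-- Apply `φ` to `ε R R⋆ ≤ R (Im y) R⋆ = -Im R`, and likewise with the factors reversed. This trades
two resolvents for the imaginary part of one, whose integral is known. -/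
theorem mul_re_map_inverse_mul_star_le (φ : 𝒜 →ₚ[ℂ] ℂ) (hε : 0 < ε)
    (hy : algebraMap ℝ 𝒜 ε ≤ ℑ y) :
    ε * (φ (Ring.inverse y * star (Ring.inverse y))).re ≤ -(φ (Ring.inverse y)).im ∧
    ε * (φ (star (Ring.inverse y) * Ring.inverse y)).re ≤ -(φ (Ring.inverse y)).im := by
  have hu := isUnit_of_le_imaginaryPart hε hy
  have e : ∀ a : 𝒜, ε * (φ a).re = (φ (ε • a)).re := fun a => by
    rw [← Complex.coe_smul, map_smul]
    simp
  constructor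
  · have h := star_right_conjugate_le_conjugate hy (Ring.inverse y)
    rw [mul_imaginaryPart_mul_star (Ring.inverse_mul_cancel _ hu), ← Algebra.commutes, mul_assoc,
      ← Algebra.smul_def] at h
    have h2 := re_map_mono φ h
    rwa [map_neg, Complex.neg_re, re_map_imaginaryPart, ← e] at h2
  · have h := star_left_conjugate_le_conjugate hy (Ring.inverse y)
    rw [star_mul_imaginaryPart_mul (Ring.mul_inverse_cancel _ hu), ← Algebra.commutes, mul_assoc,
      ← Algebra.smul_def] at h
    have h2 := re_map_mono φ h
    rwa [map_neg, Complex.neg_re, re_map_imaginaryPart, ← e] at h2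

theorem norm_map_inverse_sub_inverse_le (φ : 𝒜 →ₚ[ℂ] ℂ) (hε : 0 < ε)
    (hy : algebraMap ℝ 𝒜 ε ≤ ℑ y) (hz : algebraMap ℝ 𝒜 ε ≤ ℑ z) :
    ‖φ (Ring.inverse y) - φ (Ring.inverse z)‖ ≤
      ‖z - y‖ * ((-(φ (Ring.inverse y)).im + -(φ (Ring.inverse z)).im) / (2 * ε)) := by
  rw [← map_sub, inverse_sub_inverse (isUnit_of_le_imaginaryPart hε hy)
    (isUnit_of_le_imaginaryPart hε hz)]
  refine (norm_map_mul_mul_le φ _ _ _).trans ?_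
  refine mul_le_mul_of_nonneg_left ?_ (norm_nonneg _)
  have h1 := (mul_re_map_inverse_mul_star_le φ hε hy).1
  have h2 := (mul_re_map_inverse_mul_star_le φ hε hz).2
  rw [div_le_div_iff₀ (by norm_num) (by positivity)]
  linarith

theorem coe_imaginaryPart_algebraMap (z : ℂ) :
    (ℑ (algebraMap ℂ 𝒜 z) : 𝒜) = algebraMap ℝ 𝒜 z.im := by
  rw [coe_imaginaryPart_eq, ← algebraMap_star_comm, ← map_sub, Algebra.smul_def, ← map_mul,
    IsScalarTower.algebraMap_apply ℝ ℂ 𝒜]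
  congr 1
  apply Complex.ext <;> simp
  ring

theorem le_imaginaryPart_algebraMap {z : ℂ} (hz : ε ≤ z.im) :
    algebraMap ℝ 𝒜 ε ≤ ℑ (algebraMap ℂ 𝒜 z) := by
  rw [coe_imaginaryPart_algebraMap]
  exact algebraMap_mono _ hz

end State

/-! ### The scalar Cauchy transforms -/

section Scalar

variable {𝒜 : Type*} [CStarAlgebra 𝒜] [PartialOrder 𝒜] [StarOrderedRing 𝒜]
  {φ : 𝒜 →ₚ[ℂ] ℂ} {Φ H₀ H₁ : 𝒜 →L[ℂ] 𝒜} {x₀ x₁ : 𝒜} {ε K : ℝ}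

theorem IsCondExp.map_algebraMap_complex (hΦ : IsCondExp (Φ : 𝒜 →ₗ[ℂ] 𝒜)) (z : ℂ) :
    Φ (algebraMap ℂ 𝒜 z) = algebraMap ℂ 𝒜 z := by
  have : Φ 1 = 1 := hΦ.map_one
  rw [Algebra.algebraMap_eq_smul_one, map_smul, this]

theorem differentiableOn_interpolation (φ : 𝒜 →ₚ[ℂ] ℂ) (hΦ : IsCondExp (Φ : 𝒜 →ₗ[ℂ] 𝒜))
    (hx₀ : IsSelfAdjoint x₀) (hx₁ : IsSelfAdjoint x₁) (s : ℝ) :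
    DifferentiableOn ℂ (fun z => φ (interpolation Φ x₀ x₁ s (algebraMap ℂ 𝒜 z)))
      {z | 0 < z.im} := by
  intro z hz
  have hb := le_imaginaryPart_algebraMap (𝒜 := 𝒜) (le_refl z.im)
  have hfix := hΦ.map_algebraMap_complex z
  have hz' : (0 : ℝ) < z.im := hz
  have hf := flow_spec hΦ hx₀ hz' hfix hb (1 - s)
  refine DifferentiableAt.differentiableWithinAt ?_
  let φL : 𝒜 →L[ℂ] ℂ := ⟨(φ : 𝒜 →ₗ[ℂ] ℂ), map_continuous φ⟩
  have h0 : DifferentiableAt ℂ (fun z => algebraMap ℂ 𝒜 z) z := by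
    simp only [Algebra.algebraMap_eq_smul_one]
    exact differentiableAt_id.smul_const _
  have h1 : DifferentiableAt ℂ (fun z => cauchyTransform Φ x₀ √(1 - s) (algebraMap ℂ 𝒜 z)) z :=
    Φ.differentiableAt.comp z ((h0.sub_const _).inverse
      (isUnit_of_le_imaginaryPart hz' (le_imaginaryPart_sub_smul hx₀ hb _)))
  have h2 : DifferentiableAt ℂ (fun z => flow Φ x₀ (1 - s) (algebraMap ℂ 𝒜 z)) z :=
    h1.inverse (cauchyTransform_spec hΦ hx₀ hz' hfix hb _).1
  have h3 : DifferentiableAt ℂ (fun z => interpolation Φ x₀ x₁ s (algebraMap ℂ 𝒜 z)) z :=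
    Φ.differentiableAt.comp z ((h2.sub_const _).inverse
      (isUnit_of_le_imaginaryPart hz' (le_imaginaryPart_sub_smul hx₁ hf.2 _)))
  exact φL.differentiableAt.comp z h3

/-- The interpolation is `Φ(y⁻¹)` with `‖z - y‖ ≤ D` uniformly in `z`. Then `z y⁻¹ = 1 + (z - y)
y⁻¹` gives `‖y⁻¹‖ = O(1/|z|)` and the error `z⁻¹ φ((z - y) y⁻¹)`. The constant may depend on `s`,
since only the exact value of the integral is used later. -/
theorem exists_norm_interpolation_sub_inv_le (hφ1 : φ 1 = 1) (hφΦ : ∀ a, φ (Φ a) = φ a)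
    (hΦ : IsCondExp (Φ : 𝒜 →ₗ[ℂ] 𝒜)) (hx₀ : IsArcsineOver Φ H₀ x₀) (hx₁ : IsSelfAdjoint x₁)
    (hε : 0 < ε) {s : ℝ} (hs : s ≤ 1) : ∃ C : ℝ, ∀ z : ℂ, ε ≤ z.im →
      ‖φ (interpolation Φ x₀ x₁ s (algebraMap ℂ 𝒜 z)) - z⁻¹‖ ≤ C / ‖z‖ ^ 2 := by
  obtain ⟨C, hC⟩ := PositiveLinearMap.exists_norm_apply_le φ
  set D : ℝ := ‖H₀‖ / ε * (1 - s) + |√s| * ‖x₁‖ with hD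
  refine ⟨C * (D * (1 + D * (1 / ε))), fun z hz => ?_⟩
  have hb := le_imaginaryPart_algebraMap (𝒜 := 𝒜) hz
  have hfix := hΦ.map_algebraMap_complex z
  have hf := flow_spec hΦ hx₀.selfAdjoint hε hfix hb (1 - s)
  have hz0 : z ≠ 0 := by
    rintro rfl
    simp at hz
    linarith
  have hzn : 0 < ‖z‖ := norm_pos_iff.2 hz0
  set y := flow Φ x₀ (1 - s) (algebraMap ℂ 𝒜 z) - √s • x₁ with hy
  have hyε : algebraMap ℝ 𝒜 ε ≤ ℑ y := le_imaginaryPart_sub_smul hx₁ hf.2 _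
  have hyu := isUnit_of_le_imaginaryPart hε hyε
  set R := Ring.inverse y with hR
  have hRn : ‖R‖ ≤ 1 / ε := norm_inverse_le_of_le_imaginaryPart hε hyε
  have hyz : ‖algebraMap ℂ 𝒜 z - y‖ ≤ D := by
    have e : algebraMap ℂ 𝒜 z - y = -(flow Φ x₀ (1 - s) (algebraMap ℂ 𝒜 z) - algebraMap ℂ 𝒜 z) +
      √s • x₁ := by rw [hy]; abel
    rw [e]
    refine (norm_add_le _ _).trans ?_
    rw [norm_neg, norm_smul, Real.norm_eq_abs]
    exact add_le_add_left (norm_flow_sub_le hΦ hx₀ hε hfix hb (by linarith)) _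
  have hD0 : 0 ≤ D := (norm_nonneg _).trans hyz
  have e1 : z • R = 1 + (algebraMap ℂ 𝒜 z - y) * R := by
    rw [sub_mul, Ring.mul_inverse_cancel _ hyu, ← Algebra.smul_def]
    abel
  have hone : ‖(1 : 𝒜)‖ ≤ 1 := by
    nontriviality 𝒜
    rw [CStarRing.norm_one]
  have h1 : ‖z‖ * ‖R‖ ≤ 1 + D * (1 / ε) := by
    rw [← norm_smul, e1]
    refine (norm_add_le _ _).trans (add_le_add hone ((norm_mul_le _ _).trans ?_))
    gcongr
  have e2 : φ (interpolation Φ x₀ x₁ s (algebraMap ℂ 𝒜 z)) - z⁻¹ =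
      z⁻¹ * φ ((algebraMap ℂ 𝒜 z - y) * R) := by
    have e3 : φ (interpolation Φ x₀ x₁ s (algebraMap ℂ 𝒜 z)) = φ R := hφΦ R
    have e4 : (algebraMap ℂ 𝒜 z - y) * R = z • R - 1 := by rw [e1]; abel
    rw [e3, e4, map_sub, map_smul, hφ1, smul_eq_mul, mul_sub, inv_mul_cancel_left₀ hz0, mul_one]
  rw [e2, norm_mul, norm_inv, div_eq_inv_mul, pow_two, mul_inv, mul_assoc]
  gcongr
  have h2 : ‖R‖ ≤ ‖z‖⁻¹ * (1 + D * (1 / ε)) := by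
    rw [← div_eq_inv_mul, le_div_iff₀ hzn]
    linarith
  calc ‖φ ((algebraMap ℂ 𝒜 z - y) * R)‖ ≤ C * (D * (‖z‖⁻¹ * (1 + D * (1 / ε)))) := by
        refine (hC _).trans ?_
        gcongr
        exact (norm_mul_le _ _).trans (mul_le_mul hyz h2 (norm_nonneg _) hD0)
    _ = _ := by ring

theorem integral_interpolation (hφ1 : φ 1 = 1) (hφΦ : ∀ a, φ (Φ a) = φ a)
    (hΦ : IsCondExp (Φ : 𝒜 →ₗ[ℂ] 𝒜)) (hx₀ : IsArcsineOver Φ H₀ x₀) (hx₁ : IsSelfAdjoint x₁)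
    (hε : 0 < ε) {s : ℝ} (hs : s ≤ 1) :
    Integrable (fun t : ℝ =>
      -(φ (interpolation Φ x₀ x₁ s (algebraMap ℂ 𝒜 (t + ε * Complex.I)))).im) ∧
    ∫ t : ℝ, -(φ (interpolation Φ x₀ x₁ s (algebraMap ℂ 𝒜 (t + ε * Complex.I)))).im =
      Real.pi := by
  obtain ⟨C, hC⟩ := exists_norm_interpolation_sub_inv_le hφ1 hφΦ hΦ hx₀ hx₁ hε hs
  exact integral_neg_im_horizontal
    (differentiableOn_interpolation φ hΦ hx₀.selfAdjoint hx₁ s) hε hC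

/-- The `L¹` estimate for the difference of two scalar Cauchy transforms along a horizontal line. -/
theorem integral_norm_cauchyTransform_sub_le (hφ1 : φ 1 = 1) (hφΦ : ∀ a, φ (Φ a) = φ a)
    (hΦ : IsCondExp (Φ : 𝒜 →ₗ[ℂ] 𝒜)) (hx₀ : IsArcsineOver Φ H₀ x₀)
    (hx₁ : IsArcsineOver Φ H₁ x₁) (hK : ∀ a, ‖H₁ a - H₀ a‖ ≤ K * ‖a‖) (hK0 : 0 ≤ K)
    (hε : 0 < ε) :
    Integrable (fun t : ℝ => φ (cauchyTransform Φ x₁ 1 (algebraMap ℂ 𝒜 (t + ε * Complex.I))) -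
      φ (cauchyTransform Φ x₀ 1 (algebraMap ℂ 𝒜 (t + ε * Complex.I)))) ∧
    ∫ t : ℝ, ‖φ (cauchyTransform Φ x₁ 1 (algebraMap ℂ 𝒜 (t + ε * Complex.I))) -
      φ (cauchyTransform Φ x₀ 1 (algebraMap ℂ 𝒜 (t + ε * Complex.I)))‖ ≤
        Real.pi * (K / ε ^ 2) := by
  set p : ℝ → ℝ → ℝ := fun s t =>
    -(φ (interpolation Φ x₀ x₁ s (algebraMap ℂ 𝒜 (t + ε * Complex.I)))).im with hp
  have hpi : ∀ s ≤ 1, Integrable (p s) ∧ ∫ t, p s t = Real.pi := fun s hs =>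
    integral_interpolation hφ1 hφΦ hΦ hx₀ hx₁.selfAdjoint hε hs
  have hb : ∀ t : ℝ, algebraMap ℝ 𝒜 ε ≤ ℑ (algebraMap ℂ 𝒜 (t + ε * Complex.I)) := fun t =>
    le_imaginaryPart_algebraMap (by simp)
  have hfix : ∀ t : ℝ, Φ (algebraMap ℂ 𝒜 (t + ε * Complex.I)) =
    algebraMap ℂ 𝒜 (t + ε * Complex.I) := fun t => hΦ.map_algebraMap_complex _
  set D : ℝ → ℂ := fun t => φ (cauchyTransform Φ x₁ 1 (algebraMap ℂ 𝒜 (t + ε * Complex.I))) -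
      φ (cauchyTransform Φ x₀ 1 (algebraMap ℂ 𝒜 (t + ε * Complex.I))) with hD
  set δ : ℕ → ℝ := fun N =>
    (K / ε + ‖H₀‖ * (1 / ε ^ 2) * ((‖H₁‖ + ‖H₀‖) / ε * (1 / N))) * (1 / N) with hδ
  have hpt : ∀ N : ℕ, 0 < N → ∀ t : ℝ, ‖D t‖ ≤ ∑ i ∈ Finset.range N,
      δ N / (2 * ε) * (p (i / N + 1 / N) t + p (i / N) t) := by
    intro N hN t
    have hN' : (0 : ℝ) < N := by exact_mod_cast hN
    rw [hD]
    simp only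
    rw [← map_sub, interpolation_sub_eq_sum hΦ hx₀.selfAdjoint hε (hfix t) (hb t) hN, map_sum]
    refine (norm_sum_le _ _).trans (Finset.sum_le_sum fun i hi => ?_)
    obtain ⟨y, z, hy, hz, hyz, e1, e0⟩ := exists_interpolation_increment hΦ hx₀ hx₁ hK hK0 hε
      (hfix t) (hb t) (s := i / N) (h := 1 / N) (by positivity) (by positivity)
      (div_add_inv_le_one (Finset.mem_range.1 hi))
    rw [hp]
    simp only
    rw [map_sub, e1, e0, hφΦ, hφΦ]
    refine (norm_map_inverse_sub_inverse_le φ hε hy hz).trans ?_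
    have h1 := (mul_re_map_inverse_mul_star_le φ hε hy).1
    have h2 := (mul_re_map_inverse_mul_star_le φ hε hz).1
    have h3 : ∀ a : 𝒜, 0 ≤ (φ (a * star a)).re := fun a =>
      (Complex.le_def.1 (map_nonneg φ (mul_star_self_nonneg a))).1
    have h4 := mul_nonneg hε.le (h3 (Ring.inverse y))
    have h5 := mul_nonneg hε.le (h3 (Ring.inverse z))
    rw [div_mul_eq_mul_div, mul_div_assoc]
    refine mul_le_mul_of_nonneg_right hyz (div_nonneg ?_ (by positivity))
    linarith
  have hint : ∀ N : ℕ, ∀ i ∈ Finset.range N,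
      Integrable fun t => δ N / (2 * ε) * (p (i / N + 1 / N) t + p (i / N) t) := by
    intro N i hi
    have hle := div_add_inv_le_one (Finset.mem_range.1 hi)
    have hle' : (i / N : ℝ) ≤ 1 := le_trans (le_add_of_nonneg_right (by positivity)) hle
    exact ((hpi _ hle).1.add (hpi _ hle').1).const_mul _
  have hcont : Continuous D := by
    have h : ∀ s : ℝ, Continuous fun t : ℝ =>
        φ (interpolation Φ x₀ x₁ s (algebraMap ℂ 𝒜 (t + ε * Complex.I))) := fun s =>
      continuous_horizontal (differentiableOn_interpolation φ hΦ hx₀.selfAdjoint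
        hx₁.selfAdjoint s) hε
    have h1 := h 1
    have h0 := h 0
    simp only [interpolation_one hΦ hε (hfix _) (hb _)] at h1
    simp only [interpolation_zero hΦ hx₀.selfAdjoint hε (hfix _) (hb _)] at h0
    exact h1.sub h0
  -- The pointwise bound with a single step, `N = 1`, already gives an integrable majorant.
  have hDi : Integrable D :=
    (integrable_finsetSum _ (hint 1)).mono' hcont.aestronglyMeasurable
      (ae_of_all _ (hpt 1 one_pos))
  refine ⟨hDi, le_of_forall_nat_add_div
    (L := Real.pi / ε * (‖H₀‖ * (1 / ε ^ 2) * ((‖H₁‖ + ‖H₀‖) / ε))) fun N hN => ?_⟩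
  have hN' : (0 : ℝ) < N := by exact_mod_cast hN
  refine (integral_mono hDi.norm (integrable_finsetSum _ (hint N)) (hpt N hN)).trans_eq ?_
  rw [integral_finsetSum _ (hint N)]
  have hval : ∀ i ∈ Finset.range N,
      ∫ t, δ N / (2 * ε) * (p (i / N + 1 / N) t + p (i / N) t) =
        δ N / (2 * ε) * (2 * Real.pi) := by
    intro i hi
    have hle := div_add_inv_le_one (Finset.mem_range.1 hi)
    have hle' : (i / N : ℝ) ≤ 1 := le_trans (le_add_of_nonneg_right (by positivity)) hle
    rw [integral_const_mul, integral_add (hpi _ hle).1 (hpi _ hle').1, (hpi _ hle).2,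
      (hpi _ hle').2, ← two_mul]
  rw [Finset.sum_congr rfl hval, Finset.sum_const, Finset.card_range, nsmul_eq_mul, hδ]
  field_simp

end Scalar

/-! ### Smoothing by the Cauchy distribution -/

section Levy

open Filter Topology

/-- The distribution function of the standard Cauchy distribution. -/
def cauchyCDF (v : ℝ) : ℝ := 1 / 2 + Real.arctan v / Real.pi

theorem cauchyCDF_mono : Monotone cauchyCDF := fun v w h => by
  unfold cauchyCDF
  gcongr

theorem cauchyCDF_nonneg (v : ℝ) : 0 ≤ cauchyCDF v := by
  have h := Real.neg_pi_div_two_lt_arctan v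
  have h2 : -(1 / 2) ≤ Real.arctan v / Real.pi := by
    rw [le_div_iff₀ Real.pi_pos]
    linarith
  unfold cauchyCDF
  linarith

theorem cauchyCDF_le_one (v : ℝ) : cauchyCDF v ≤ 1 := by
  have h := Real.arctan_lt_pi_div_two v
  have h2 : Real.arctan v / Real.pi ≤ 1 / 2 := by
    rw [div_le_iff₀ Real.pi_pos]
    linarith
  unfold cauchyCDF
  linarith

theorem cauchyCDF_neg (v : ℝ) : cauchyCDF (-v) = 1 - cauchyCDF v := by
  unfold cauchyCDF
  rw [Real.arctan_neg]
  ring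

/-- Follows from `arctan w = π/2 - arctan w⁻¹` and `arctan v ≤ v` for `v ≥ 0`. -/
theorem one_sub_le_cauchyCDF {w : ℝ} (hw : 0 < w) : 1 - 1 / (Real.pi * w) ≤ cauchyCDF w := by
  have h1 := Real.arctan_inv_of_pos hw
  have h2 : Real.arctan w⁻¹ ≤ w⁻¹ := by
    have := Real.le_tan (Real.arctan_nonneg.2 (inv_nonneg.2 hw.le))
      (Real.arctan_lt_pi_div_two w⁻¹)
    rwa [Real.tan_arctan] at this
  have h3 : Real.pi / 2 - w⁻¹ ≤ Real.arctan w := by linarith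
  have h4 : (Real.pi / 2 - w⁻¹) / Real.pi ≤ Real.arctan w / Real.pi := by gcongr
  have h5 : (Real.pi / 2 - w⁻¹) / Real.pi = 1 / 2 - 1 / (Real.pi * w) := by
    field_simp
  unfold cauchyCDF
  linarith

theorem continuous_cauchyCDF : Continuous cauchyCDF :=
  continuous_const.add (Real.continuous_arctan.div_const _)

theorem hasDerivAt_cauchyCDF {ε : ℝ} (hε : 0 < ε) (y s : ℝ) :
    HasDerivAt (fun s => cauchyCDF ((s - y) / ε))
      (1 / Real.pi * (ε * (1 / ((s - y) ^ 2 + ε ^ 2)))) s := by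
  have h := ((((hasDerivAt_id s).sub_const y).div_const ε).arctan.div_const Real.pi).const_add
    (1 / 2)
  refine h.congr_deriv ?_
  simp only [id]
  field_simp
  ring

/-- The distribution function of the convolution of `μ` with a Cauchy distribution. -/
def smoothCDF (μ : Measure ℝ) (ε t : ℝ) : ℝ := ∫ y, cauchyCDF ((t - y) / ε) ∂μ

theorem continuous_cauchyCDF_comp (ε t : ℝ) : Continuous fun y => cauchyCDF ((t - y) / ε) :=
  continuous_cauchyCDF.comp (by fun_prop)

variable (μ ν : Measure ℝ) [IsProbabilityMeasure μ] [IsProbabilityMeasure ν]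

theorem integrable_cauchyCDF_comp (ε t : ℝ) : Integrable (fun y => cauchyCDF ((t - y) / ε)) μ :=
  Integrable.of_bound (continuous_cauchyCDF_comp ε t).aestronglyMeasurable 1
    (ae_of_all _ fun y => by
      rw [Real.norm_of_nonneg (cauchyCDF_nonneg _)]
      exact cauchyCDF_le_one _)

theorem integral_indicator_Iic_add (s δ : ℝ) :
    ∫ y, (Set.Iic s).indicator (fun _ => (1 : ℝ)) y + δ ∂μ = μ.real (Set.Iic s) + δ := by
  rw [integral_add ((integrable_const _).indicator measurableSet_Iic) (integrable_const _),
    integral_indicator measurableSet_Iic]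
  simp

/-- A Cauchy variable of scale `ε` exceeds `δ` with probability at most `ε / (π δ)`; `hδε` balances
this tail against the shift. -/
theorem smoothCDF_le {ε δ : ℝ} (hε : 0 < ε) (hδ : 0 < δ) (hδε : ε / (Real.pi * δ) = δ) (t : ℝ) :
    smoothCDF μ ε t ≤ μ.real (Set.Iic (t + δ)) + δ := by
  rw [← integral_indicator_Iic_add]
  refine integral_mono (integrable_cauchyCDF_comp μ ε t)
    (((integrable_const _).indicator measurableSet_Iic).add (integrable_const _)) fun y => ?_
  simp only
  rcases le_or_gt y (t + δ) with h | h
  · rw [Set.indicator_of_mem (by exact h)]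
    linarith [cauchyCDF_le_one ((t - y) / ε)]
  · rw [Set.indicator_of_notMem (by simpa using h), zero_add]
    have h1 : (t - y) / ε ≤ -(δ / ε) := by
      rw [← neg_div]
      gcongr
      linarith
    have h2 := one_sub_le_cauchyCDF (div_pos hδ hε)
    have h3 : 1 / (Real.pi * (δ / ε)) = δ := by
      rw [← hδε]
      have hπ := Real.pi_ne_zero
      calc 1 / (Real.pi * (ε / (Real.pi * δ) / ε)) = δ := by field_simp
        _ = ε / (Real.pi * δ) := hδε.symm
    refine (cauchyCDF_mono h1).trans ?_
    rw [cauchyCDF_neg]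
    linarith

theorem le_smoothCDF {ε δ : ℝ} (hε : 0 < ε) (hδ : 0 < δ) (hδε : ε / (Real.pi * δ) = δ) (t : ℝ) :
    μ.real (Set.Iic (t - δ)) ≤ smoothCDF μ ε t + δ := by
  have h0 := integral_indicator_Iic_add μ (t - δ) 0
  rw [add_zero] at h0
  have e : smoothCDF μ ε t + δ = ∫ y, cauchyCDF ((t - y) / ε) + δ ∂μ := by
    rw [integral_add (integrable_cauchyCDF_comp μ ε t) (integrable_const _)]
    simp [smoothCDF]
  rw [← h0, e]
  refine integral_mono (((integrable_const _).indicator measurableSet_Iic).add (integrable_const _))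
    ((integrable_cauchyCDF_comp μ ε t).add (integrable_const _)) fun y => ?_
  simp only [add_zero]
  rcases le_or_gt y (t - δ) with h | h
  · rw [Set.indicator_of_mem (by exact h)]
    have h1 : δ / ε ≤ (t - y) / ε := by
      gcongr
      linarith
    have h2 := one_sub_le_cauchyCDF (div_pos hδ hε)
    have h3 : 1 / (Real.pi * (δ / ε)) = δ := by
      rw [← hδε]
      have hπ := Real.pi_ne_zero
      calc 1 / (Real.pi * (ε / (Real.pi * δ) / ε)) = δ := by field_simp
        _ = ε / (Real.pi * δ) := hδε.symm
    linarith [cauchyCDF_mono h1]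
  · rw [Set.indicator_of_notMem (by simpa using h)]
    linarith [cauchyCDF_nonneg ((t - y) / ε)]

/-- Smoothing and unsmoothing each cost `δ = √(ε/π)` in both shift and height, once for `μ` and once
for `ν`. -/
theorem levyDist_le_of_smoothCDF {ε Δ : ℝ} (hε : 0 < ε)
    (h : ∀ t, |smoothCDF μ ε t - smoothCDF ν ε t| ≤ Δ) :
    levyDist μ ν ≤ 2 * √(ε / Real.pi) + Δ := by
  have hΔ : 0 ≤ Δ := (abs_nonneg _).trans (h 0)
  set δ := √(ε / Real.pi) with hδdef
  have hδ : 0 < δ := Real.sqrt_pos.2 (div_pos hε Real.pi_pos)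
  have hsq : δ * δ = ε / Real.pi := Real.mul_self_sqrt (div_pos hε Real.pi_pos).le
  have hδε : ε / (Real.pi * δ) = δ := by
    rw [← div_div, ← hsq]
    field_simp
  refine csInf_le ⟨0, fun e he => he.1.le⟩ ⟨by positivity, fun t => ⟨?_, ?_⟩⟩
  · have h1 : μ.real (Set.Iic (t - (2 * δ + Δ))) ≤ μ.real (Set.Iic (t - δ - δ)) :=
      measureReal_mono (Set.Iic_subset_Iic.2 (by linarith))
    have h2 := le_smoothCDF μ hε hδ hδε (t - δ)
    have h3 := smoothCDF_le ν hε hδ hδε (t - δ)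
    rw [sub_add_cancel] at h3
    have h4 := (abs_le.1 (h (t - δ))).2
    linarith
  · have h1 : μ.real (Set.Iic (t + δ + δ)) ≤ μ.real (Set.Iic (t + (2 * δ + Δ))) :=
      measureReal_mono (Set.Iic_subset_Iic.2 (by linarith))
    have h2 := le_smoothCDF ν hε hδ hδε (t + δ)
    rw [add_sub_cancel_right] at h2
    have h3 := smoothCDF_le μ hε hδ hδε (t + δ)
    have h4 := (abs_le.1 (h (t + δ))).1
    linarith

theorem tendsto_smoothCDF_atBot {ε : ℝ} (hε : 0 < ε) :
    Tendsto (fun t => smoothCDF μ ε t) atBot (𝓝 0) := by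
  have h0 : Tendsto cauchyCDF atBot (𝓝 0) := by
    have h1 := (tendsto_nhds_of_tendsto_nhdsWithin Real.tendsto_arctan_atBot).div_const Real.pi
    have h2 := h1.const_add (1 / 2)
    have e : 1 / 2 + -(Real.pi / 2) / Real.pi = 0 := by
      have := Real.pi_ne_zero
      field_simp
      ring
    rw [e] at h2
    exact h2
  have h := tendsto_integral_filter_of_dominated_convergence (μ := μ) (l := (atBot : Filter ℝ))
    (F := fun t y => cauchyCDF ((t - y) / ε)) (f := fun _ => 0) (fun _ => 1)
    (Eventually.of_forall fun t => (continuous_cauchyCDF_comp ε t).aestronglyMeasurable)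
    (Eventually.of_forall fun t => ae_of_all _ fun y => by
      rw [Real.norm_of_nonneg (cauchyCDF_nonneg _)]
      exact cauchyCDF_le_one _) (integrable_const _)
    (ae_of_all _ fun y => h0.comp
      ((tendsto_atBot_add_const_right _ (-y) tendsto_id).atBot_div_const hε))
  simp only [integral_zero] at h
  exact h

/-- Fubini: the Poisson kernel is the derivative in `s` of `cauchyCDF ((s - y) / ε)`. -/
theorem smoothCDF_sub_eq {ε : ℝ} (hε : 0 < ε) {a t : ℝ} (hat : a ≤ t) :
    smoothCDF μ ε t - smoothCDF μ ε a =
      ∫ s in a..t, 1 / Real.pi * ∫ y, ε * (1 / ((s - y) ^ 2 + ε ^ 2)) ∂μ := by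
  have hc : Continuous (Function.uncurry fun s y : ℝ =>
      1 / Real.pi * (ε * (1 / ((s - y) ^ 2 + ε ^ 2)))) := by
    refine continuous_const.mul (continuous_const.mul (continuous_const.div (by fun_prop) ?_))
    intro q
    positivity
  have hbd : ∀ q, ‖Function.uncurry (fun s y : ℝ =>
      1 / Real.pi * (ε * (1 / ((s - y) ^ 2 + ε ^ 2)))) q‖ ≤ 1 / Real.pi * (ε * (1 / ε ^ 2)) := by
    rintro ⟨s, y⟩
    simp only [Function.uncurry]
    rw [Real.norm_of_nonneg (by positivity)]
    gcongr
    nlinarith [sq_nonneg (s - y)]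
  have hfub := integral_integral_swap (μ := volume.restrict (Set.Ioc a t)) (ν := μ)
    (f := fun s y : ℝ => 1 / Real.pi * (ε * (1 / ((s - y) ^ 2 + ε ^ 2))))
    (Integrable.of_bound hc.aestronglyMeasurable _ (ae_of_all _ hbd))
  rw [smoothCDF, smoothCDF, ← integral_sub (integrable_cauchyCDF_comp μ ε t)
    (integrable_cauchyCDF_comp μ ε a), intervalIntegral.integral_of_le hat]
  have hpull : ∀ s : ℝ, 1 / Real.pi * ∫ y, ε * (1 / ((s - y) ^ 2 + ε ^ 2)) ∂μ =
      ∫ y, 1 / Real.pi * (ε * (1 / ((s - y) ^ 2 + ε ^ 2))) ∂μ := fun s =>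
    (integral_const_mul _ _).symm
  simp only [hpull]
  refine Eq.trans (integral_congr_ae (ae_of_all _ fun y => ?_)) hfub.symm
  simp only
  have hcy : Continuous fun s : ℝ => 1 / Real.pi * (ε * (1 / ((s - y) ^ 2 + ε ^ 2))) :=
    hc.comp (by fun_prop : Continuous fun s : ℝ => (s, y))
  have hy : ∫ s in a..t, 1 / Real.pi * (ε * (1 / ((s - y) ^ 2 + ε ^ 2))) =
      cauchyCDF ((t - y) / ε) - cauchyCDF ((a - y) / ε) :=
    intervalIntegral.integral_eq_sub_of_hasDerivAt
      (fun s _ => hasDerivAt_cauchyCDF hε y s) (hcy.intervalIntegrable _ _)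
  rw [intervalIntegral.integral_of_le hat] at hy
  exact hy.symm

end Levy

/-! ### Distributions -/

section Distribution

open Filter Topology

variable {A : Type*} [CStarAlgebra A] [PartialOrder A] [StarOrderedRing A]

theorem isProbabilityMeasure_distribution {φ : A →ₚ[ℂ] ℂ} (hφ1 : φ 1 = 1) {x : A}
    (hx : IsSelfAdjoint x) : IsProbabilityMeasure (distribution φ hx) := by
  have h := integral_distribution φ hx (fun _ => 1) continuous_const
  rw [cfc_const_one ℝ x hx, hφ1] at h
  simp only [integral_const, smul_eq_mul, mul_one, Complex.one_re] at h
  constructor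
  rw [measureReal_def] at h
  rwa [ENNReal.toReal_eq_one_iff] at h

/-- Stieltjes inversion density: the imaginary part of the scalar Cauchy transform. -/
theorem neg_im_scalarCauchy (φ : A →ₚ[ℂ] ℂ) {x : A} (hx : IsSelfAdjoint x) {ε : ℝ} (hε : 0 < ε)
    (s : ℝ) : -(scalarCauchy φ x (s + ε * Complex.I)).im =
      ∫ y, ε * (1 / ((s - y) ^ 2 + ε ^ 2)) ∂(distribution φ hx) := by
  have hcont : Continuous fun y : ℝ => 1 / ((s - y) ^ 2 + ε ^ 2) :=
    continuous_const.div (by fun_prop) fun y => by positivity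
  rw [integral_const_mul, integral_distribution φ hx _ hcont]
  set z : ℂ := s + ε * Complex.I with hz
  set y : A := algebraMap ℂ A z - x with hy
  have hyim : (ℑ y : A) = algebraMap ℝ A ε := by
    rw [hy, map_sub, imaginaryPart_eq_zero_iff.2 hx, sub_zero, coe_imaginaryPart_algebraMap]
    simp [hz]
  have hyu : IsUnit y := isUnit_of_le_imaginaryPart hε hyim.ge
  set R := Ring.inverse y with hR
  have hRy : R * y = 1 := Ring.inverse_mul_cancel _ hyu
  have hyR : y * R = 1 := Ring.mul_inverse_cancel _ hyu
  have h1 := mul_imaginaryPart_mul_star hRy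
  rw [hyim, ← Algebra.commutes, mul_assoc, ← Algebra.smul_def] at h1
  have h2 : -(φ R).im = ε * (φ (R * star R)).re := by
    rw [← re_map_imaginaryPart, ← Complex.neg_re, ← map_neg, ← h1, ← Complex.coe_smul, map_smul]
    simp
  -- Since `-Im φ(R) = ε φ(R R⋆)` and `R R⋆` is inverse to `y⋆y`, it suffices to identify `y⋆y` in
  -- the functional calculus of `x`.
  have hquad : star y * y = cfc (fun t : ℝ => (s - t) ^ 2 + ε ^ 2) x := by
    have e1 : cfc (fun t : ℝ => (s - t) ^ 2 + ε ^ 2) x =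
        (algebraMap ℝ A s - x) ^ 2 + algebraMap ℝ A (ε ^ 2) := by
      rw [cfc_add (a := x) (fun t : ℝ => (s - t) ^ 2) (fun _ => ε ^ 2) (by fun_prop) (by fun_prop),
        cfc_pow (fun t : ℝ => s - t) 2 x (by fun_prop) hx,
        cfc_sub (fun _ : ℝ => s) (fun t => t) x (by fun_prop) (by fun_prop),
        cfc_const s x hx, cfc_const (ε ^ 2) x hx, cfc_id' ℝ x hx]
    have e2 : y = (algebraMap ℝ A s - x) + Complex.I • algebraMap ℝ A ε := by
      rw [hy, hz, map_add, map_mul, IsScalarTower.algebraMap_apply ℝ ℂ A s,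
        IsScalarTower.algebraMap_apply ℝ ℂ A ε, Algebra.smul_def, ← map_mul, mul_comm]
      simp only [Complex.coe_algebraMap, map_mul]
      abel
    have hsa : star (algebraMap ℝ A s - x) = algebraMap ℝ A s - x := by
      rw [star_sub, hx.star_eq, ← algebraMap_star_comm, star_trivial]
    rw [e1, e2]
    generalize algebraMap ℝ A s - x = v at hsa ⊢
    rw [star_add, hsa, star_smul, ← algebraMap_star_comm, star_trivial ε, RCLike.star_def,
      Complex.conj_I, map_pow]
    have hcomm : algebraMap ℝ A ε * v = v * algebraMap ℝ A ε := Algebra.commutes ε v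
    simp only [add_mul, mul_add, smul_mul_assoc, mul_smul_comm, smul_add, smul_neg, smul_smul, hcomm, pow_two,
      neg_smul, neg_mul, Complex.I_mul_I, neg_neg, one_smul]
    abel
  have hinv : cfc (fun t : ℝ => (s - t) ^ 2 + ε ^ 2) x *
      cfc (fun t : ℝ => 1 / ((s - t) ^ 2 + ε ^ 2)) x = 1 := by
    rw [← cfc_mul _ _ x (by fun_prop) hcont.continuousOn, ← cfc_const_one ℝ x hx]
    congr 1
    funext t
    have : (s - t) ^ 2 + ε ^ 2 ≠ 0 := by positivity
    field_simp
  have hRR : R * star R = cfc (fun t : ℝ => 1 / ((s - t) ^ 2 + ε ^ 2)) x := by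
    have h3 : R * star R * (star y * y) = 1 := by
      rw [mul_assoc, ← mul_assoc (star R), ← star_mul, hyR, star_one, one_mul, hRy]
    rw [← mul_one (R * star R), ← hinv, ← hquad, ← mul_assoc, h3, one_mul]
  rw [← hRR, ← h2]
  rfl

/-- The smoothing inequality for the Lévy distance. -/
theorem levyDist_distribution_le {φ : A →ₚ[ℂ] ℂ} (hφ1 : φ 1 = 1) {x y : A}
    (hx : IsSelfAdjoint x) (hy : IsSelfAdjoint y) {ε : ℝ} (hε : 0 < ε)
    (hi : Integrable fun t : ℝ => scalarCauchy φ x (t + ε * Complex.I) -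
      scalarCauchy φ y (t + ε * Complex.I)) :
    levyDist (distribution φ hx) (distribution φ hy) ≤ 2 * √(ε / Real.pi) +
      1 / Real.pi * ∫ t : ℝ, ‖scalarCauchy φ x (t + ε * Complex.I) -
        scalarCauchy φ y (t + ε * Complex.I)‖ := by
  have := isProbabilityMeasure_distribution hφ1 hx
  have := isProbabilityMeasure_distribution hφ1 hy
  refine levyDist_le_of_smoothCDF _ _ hε fun t => ?_
  have hcont : ∀ {w : A} (hw : IsSelfAdjoint w),
      Continuous fun s : ℝ => -(scalarCauchy φ w (s + ε * Complex.I)).im := by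
    intro w hw
    have hd : Continuous fun s : ℝ => scalarCauchy φ w (s + ε * Complex.I) := by
      refine (map_continuous φ).comp (continuous_iff_continuousAt.2 fun s => ?_)
      have hle : algebraMap ℝ A ε ≤ ℑ (algebraMap ℂ A (s + ε * Complex.I) - w) := by
        rw [map_sub, imaginaryPart_eq_zero_iff.2 hw, sub_zero]
        exact le_imaginaryPart_algebraMap (by simp)
      have h1 := (differentiableAt_inverse (𝕜 := ℂ)
        (isUnit_of_le_imaginaryPart hε hle)).continuousAt
      have h2 : Continuous fun s : ℝ => algebraMap ℂ A (s + ε * Complex.I) - w :=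
        ((continuous_algebraMap ℂ A).comp (by fun_prop)).sub continuous_const
      exact ContinuousAt.comp (f := fun s : ℝ => algebraMap ℂ A (s + ε * Complex.I) - w) h1
        h2.continuousAt
    exact (Complex.continuous_im.comp hd).neg
  set D : ℝ → ℂ := fun t => scalarCauchy φ x (t + ε * Complex.I) -
    scalarCauchy φ y (t + ε * Complex.I) with hD
  have hfin : ∀ a ≤ t, |smoothCDF (distribution φ hx) ε t - smoothCDF (distribution φ hy) ε t| ≤
      |smoothCDF (distribution φ hx) ε a - smoothCDF (distribution φ hy) ε a| +
        1 / Real.pi * ∫ t : ℝ, ‖D t‖ := by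
    intro a hat
    have e1 := smoothCDF_sub_eq (distribution φ hx) hε hat
    have e2 := smoothCDF_sub_eq (distribution φ hy) hε hat
    simp only [← neg_im_scalarCauchy φ _ hε] at e1 e2
    have e3 : smoothCDF (distribution φ hx) ε t - smoothCDF (distribution φ hy) ε t =
        (smoothCDF (distribution φ hx) ε a - smoothCDF (distribution φ hy) ε a) +
          ∫ s in a..t, 1 / Real.pi * -(D s).im := by
      have e4 : ∀ s, 1 / Real.pi * -(D s).im =
          1 / Real.pi * -(scalarCauchy φ x (s + ε * Complex.I)).im -
          1 / Real.pi * -(scalarCauchy φ y (s + ε * Complex.I)).im := fun s => by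
        rw [hD, Complex.sub_im]
        ring
      simp only [e4]
      rw [intervalIntegral.integral_sub
        (((hcont hx).const_mul _).intervalIntegrable _ _)
        (((hcont hy).const_mul _).intervalIntegrable _ _), ← e1, ← e2]
      ring
    rw [e3]
    refine (abs_add_le _ _).trans (add_le_add_right ?_ _)
    rw [intervalIntegral.integral_const_mul, abs_mul, abs_of_pos (by positivity)]
    refine mul_le_mul_of_nonneg_left ?_ (by positivity)
    rw [← Real.norm_eq_abs]
    refine (intervalIntegral.norm_integral_le_integral_norm hat).trans ?_
    rw [intervalIntegral.integral_of_le hat]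
    refine le_trans (integral_mono_of_nonneg (ae_of_all _ fun _ => norm_nonneg _)
      hi.norm.integrableOn (ae_of_all _ fun s => ?_))
      (setIntegral_le_integral hi.norm (ae_of_all _ fun _ => norm_nonneg _))
    simp only [norm_neg, Real.norm_eq_abs]
    exact Complex.abs_im_le_norm _
  -- Letting the base point `a` tend to `-∞` removes the boundary term.
  have hlim : Tendsto (fun a => |smoothCDF (distribution φ hx) ε a -
      smoothCDF (distribution φ hy) ε a| + 1 / Real.pi * ∫ t : ℝ, ‖D t‖) atBot
      (𝓝 (|0 - 0| + 1 / Real.pi * ∫ t : ℝ, ‖D t‖)) :=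
    (((tendsto_smoothCDF_atBot _ hε).sub (tendsto_smoothCDF_atBot _ hε)).abs).add_const _
  rw [sub_zero, abs_zero, zero_add] at hlim
  refine ge_of_tendsto hlim ?_
  filter_upwards [eventually_le_atBot t] with a ha using hfin a ha

/-- Optimization of the smoothing parameter. -/
theorem le_of_forall_smoothing {L K : ℝ} (hK : 0 ≤ K)
    (h : ∀ ε : ℝ, 0 < ε → L ≤ 2 * √(ε / Real.pi) + 1 / ε ^ 2 * K) :
    L ≤ 5 * (1 / (4 * Real.pi)) ^ (2 / 5 : ℝ) * K ^ (1 / 5 : ℝ) := by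
  have hπ := Real.pi_pos
  rcases hK.eq_or_lt with rfl | hK
  · rw [Real.zero_rpow (by norm_num), mul_zero]
    refine le_of_forall_pos_le_add fun r hr => ?_
    have h1 := h (Real.pi * (r / 2) ^ 2) (by positivity)
    rw [mul_div_cancel_left₀ _ hπ.ne', Real.sqrt_sq (by positivity)] at h1
    linarith
  · set a : ℝ := (4 * Real.pi) ^ (1 / 5 : ℝ) with ha
    set k : ℝ := K ^ (1 / 5 : ℝ) with hk
    have ha0 : 0 < a := by positivity
    have hk0 : 0 < k := by positivity
    have ha5 : a ^ 5 = 4 * Real.pi := by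
      rw [ha, ← Real.rpow_natCast, ← Real.rpow_mul (by positivity)]
      norm_num
    have hk5 : k ^ 5 = K := by
      rw [hk, ← Real.rpow_natCast, ← Real.rpow_mul hK.le]
      norm_num
    have hc : (1 / (4 * Real.pi)) ^ (2 / 5 : ℝ) = 1 / a ^ 2 := by
      rw [Real.div_rpow zero_le_one (by positivity), Real.one_rpow, ha, ← Real.rpow_natCast,
        ← Real.rpow_mul (by positivity)]
      norm_num
    -- The minimizer of the right-hand side satisfies `ε⁵ = 4π K²`; the two terms become `4k / a²`
    -- and `k / a²`.
    have h1 := h (a * k ^ 2) (by positivity)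
    have hs : √(a * k ^ 2 / Real.pi) = 2 * k / a ^ 2 := by
      have : a * k ^ 2 / Real.pi = (2 * k / a ^ 2) ^ 2 := by
        have : Real.pi = a ^ 5 / 4 := by rw [ha5]; ring
        rw [this]
        field_simp
        ring
      rw [this, Real.sqrt_sq (by positivity)]
    rw [hc]
    refine h1.trans_eq ?_
    rw [hs, ← hk5]
    field_simp
    ring

/-- Fifth powers reduce the claim to a rational lower bound for `4π`. -/
theorem five_mul_rpow_lt : 5 * (1 / (4 * Real.pi)) ^ (2 / 5 : ℝ) < (1.817 : ℝ) := by
  have hπ := Real.pi_pos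
  set v : ℝ := (1 / (4 * Real.pi)) ^ (2 / 5 : ℝ) with hv
  have hv0 : 0 ≤ v := by positivity
  have hv5 : v ^ 5 = (1 / (4 * Real.pi)) ^ 2 := by
    rw [hv, ← Real.rpow_natCast, ← Real.rpow_mul (by positivity), ← Real.rpow_natCast]
    norm_num
  have h1 : v ^ 5 < (1.817 / 5) ^ 5 := by
    rw [hv5, one_div, inv_pow, inv_lt_comm₀ (by positivity) (by norm_num)]
    have h2 : (12.566 : ℝ) < 4 * Real.pi := by linarith [Real.pi_gt_d6]
    calc ((1.817 / 5 : ℝ) ^ 5)⁻¹ < 12.566 ^ 2 := by norm_num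
      _ < (4 * Real.pi) ^ 2 := by gcongr
  have h2 := lt_of_pow_lt_pow_left₀ 5 (by norm_num) h1
  linarith

end Distribution

/-! ### Specialization to operator-valued and scalar Cauchy transforms -/

section Main

theorem cauchyTransform_one {𝒜 : Type*} [CStarAlgebra 𝒜] (Φ : 𝒜 →L[ℂ] 𝒜) (x b : 𝒜) :
    cauchyTransform Φ x 1 b = Φ (Ring.inverse (b - x)) := by
  rw [cauchyTransform, one_smul]

variable {A : Type*} [CStarAlgebra A] [PartialOrder A] [StarOrderedRing A]
  {B : StarSubalgebra ℂ A} {E : A →CP A}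

theorem ovCauchy_eq_cauchyTransform (hE : IsOVProbabilitySpace B E) (k : ℕ) (x : A)
    (b : CStarMatrix (Fin k) (Fin k) A) :
    ovCauchy E k x b = cauchyTransform (hE.isCondExp_map k).toCLM (amplify k x) 1 b := by
  rw [cauchyTransform_one]
  rfl

theorem scalarCauchy_eq_cauchyTransform (hE : IsOVProbabilitySpace B E) {φ : A →ₚ[ℂ] ℂ}
    (hφ : ∀ a, φ (E a) = φ a) (x : A) (z : ℂ) :
    scalarCauchy φ x z = φ (cauchyTransform hE.isCondExp.toCLM x 1 (algebraMap ℂ A z)) := by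
  rw [cauchyTransform_one]
  exact (hφ _).symm

theorem norm_ovCauchy_sub_le (hE : IsOVProbabilitySpace B E) {η₀ η₁ : B →L[ℂ] B} {A₀ A₁ : A}
    (hsa₀ : IsSelfAdjoint A₀) (hsa₁ : IsSelfAdjoint A₁) (h₀ : IsArcsineElement B E η₀ A₀)
    (h₁ : IsArcsineElement B E η₁ A₁) {k : ℕ} {b : CStarMatrix (Fin k) (Fin k) A}
    (hb : b ∈ upperHalfPlane B k) :
    ‖ovCauchy E k A₁ b - ovCauchy E k A₀ b‖ ≤
      k * ‖Ring.inverse (ℑ b : CStarMatrix (Fin k) (Fin k) A)‖ ^ 3 * ‖η₁ - η₀‖ := by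
  rcases subsingleton_or_nontrivial (CStarMatrix (Fin k) (Fin k) A) with hs | hn
  · rw [Subsingleton.elim (ovCauchy E k A₁ b - ovCauchy E k A₀ b) 0, norm_zero]
    positivity
  obtain ⟨hpos, hle⟩ := algebraMap_inv_norm_le hb.2
  rw [ovCauchy_eq_cauchyTransform hE, ovCauchy_eq_cauchyTransform hE]
  have hfix : (hE.isCondExp_map k).toCLM b = b := by
    ext i j
    exact hE.map_of_mem _ (hb.1 i j)
  -- Here `ε = 1 / ‖(Im b)⁻¹‖`. The factor `k` in `K` comes from `norm_cstarMatrix_le`, which bounds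
  -- the amplified difference of covariances through its entries.
  refine (norm_cauchyTransform_sub_le (hE.isCondExp_map k)
    (h₀.isArcsineOver_amplify hE hsa₀ k) (h₁.isArcsineOver_amplify hE hsa₁ k)
    (K := k * ‖η₁ - η₀‖) (fun a => ?_) (by positivity) (one_div_pos.2 hpos) hfix hle).trans
    (le_of_eq ?_)
  · rw [mul_assoc]
    refine norm_cstarMatrix_le _ fun i j => (norm_covariance_sub_le hE η₁ η₀ (a i j)).trans ?_
    gcongr
    exact CStarMatrix.norm_entry_le_norm
  · rw [one_div_one_div]
    ring

end Main

end

end OVArcsine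

theorem mainTheorem7 {A : Type*} [CStarAlgebra A] [PartialOrder A] [StarOrderedRing A]
    (B : StarSubalgebra ℂ A) (E : A →CP A) (hE : OVArcsine.IsOVProbabilitySpace B E)
    (η₀ η₁ : B →L[ℂ] B) (A₀ A₁ : A) (hsa₀ : IsSelfAdjoint A₀) (hsa₁ : IsSelfAdjoint A₁)
    (h₀ : OVArcsine.IsArcsineElement B E η₀ A₀) (h₁ : OVArcsine.IsArcsineElement B E η₁ A₁) :
    (∀ (k : ℕ), ∀ b ∈ OVArcsine.upperHalfPlane B k,
      ‖OVArcsine.ovCauchy E k A₁ b - OVArcsine.ovCauchy E k A₀ b‖ ≤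
        k * ‖Ring.inverse (ℑ b : CStarMatrix (Fin k) (Fin k) A)‖ ^ 3 * ‖η₁ - η₀‖) ∧
    (∀ φ : A →ₚ[ℂ] ℂ, OVArcsine.IsWStarProbabilitySpace φ → (∀ a, φ (E a) = φ a) →
      (∀ ε : ℝ, 0 < ε →
        Integrable (fun t : ℝ => OVArcsine.scalarCauchy φ A₁ (t + ε * Complex.I) -
          OVArcsine.scalarCauchy φ A₀ (t + ε * Complex.I)) ∧
        1 / Real.pi * ∫ t : ℝ, ‖OVArcsine.scalarCauchy φ A₁ (t + ε * Complex.I) -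
          OVArcsine.scalarCauchy φ A₀ (t + ε * Complex.I)‖ ≤ 1 / ε ^ 2 * ‖η₁ - η₀‖) ∧
      OVArcsine.levyDist (OVArcsine.distribution φ hsa₁) (OVArcsine.distribution φ hsa₀) ≤
        5 * (1 / (4 * Real.pi)) ^ (2 / 5 : ℝ) * ‖η₁ - η₀‖ ^ (1 / 5 : ℝ)) ∧
    5 * (1 / (4 * Real.pi)) ^ (2 / 5 : ℝ) < (1.817 : ℝ) := by
  refine ⟨fun k b hb => OVArcsine.norm_ovCauchy_sub_le hE hsa₀ hsa₁ h₀ h₁ hb, fun φ hφ hφE => ?_,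
    OVArcsine.five_mul_rpow_lt⟩
  have key : ∀ ε : ℝ, 0 < ε →
      Integrable (fun t : ℝ => OVArcsine.scalarCauchy φ A₁ (t + ε * Complex.I) -
        OVArcsine.scalarCauchy φ A₀ (t + ε * Complex.I)) ∧
      1 / Real.pi * ∫ t : ℝ, ‖OVArcsine.scalarCauchy φ A₁ (t + ε * Complex.I) -
        OVArcsine.scalarCauchy φ A₀ (t + ε * Complex.I)‖ ≤ 1 / ε ^ 2 * ‖η₁ - η₀‖ := by
    intro ε hε
    have h := OVArcsine.integral_norm_cauchyTransform_sub_le hφ.map_one hφE hE.isCondExp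
      (h₀.isArcsineOver hE hsa₀) (h₁.isArcsineOver hE hsa₁)
      (OVArcsine.norm_covariance_sub_le hE η₁ η₀) (norm_nonneg _) hε
    simp only [OVArcsine.scalarCauchy_eq_cauchyTransform hE hφE]
    refine ⟨h.1, (mul_le_mul_of_nonneg_left h.2 (by positivity)).trans (le_of_eq ?_)⟩
    have := Real.pi_ne_zero
    field_simp
  refine ⟨key, OVArcsine.le_of_forall_smoothing (norm_nonneg _) fun ε hε => ?_⟩
  exact (OVArcsine.levyDist_distribution_le hφ.map_one hsa₁ hsa₀ hε (key ε hε).1).trans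
    (add_le_add_right (key ε hε).2 _)
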